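/- Let $I=[l,r]\subset\mathbb R$ be a nonempty compact interval, let $\mathcal D_I$ be the space of real valued càdlàg functions on $I$ endowed with Skorokhod's $J_1$ topology and its Borel $\sigma$-field, and write $\|x\|_I=\sup_{t\in I}|x(t)|$. Let $X,X_1,X_2,\dots$ be i.i.d. random elements of $\mathcal D_I$ such that the right tail of $\|X\|_I$ is regularly varying with index $\alpha\in(1,2)$, that is, $\lim_{x\to\infty}\mathbb P(\|X\|_I>cx)/\mathbb P(\|X\|_I>x)=c^{-\alpha}$ for all $c>0$. Let $(a_n)_{n\ge1}$ be a nondecreasing sequence with $\lim_{n\to\infty}n\,\mathbb P(\|X\|_I>a_n)=1$. For $\epsilon>0$, $n\ge1$ and $s,t\in I$ set $$\bar X_{\epsilon,n}(s,t)=\{X(t)-X(s)\}\mathbf 1_{\{\|X\|_I\le a_n\epsilon\}}-\mathbb E\left[\{X(t)-X(s)\}\mathbf 1_{\{\|X\|_I\le a_n\epsilon\}}\right].$$ Assume that there exist $p\in(\alpha,2]$, $\gamma>1/2$, a continuous nondecreasing function $F:I\to\mathbb R$ and nondecreasing functions $F_n:I\to\mathbb R$, $n\ge1$, with $F_n\to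 F$ pointwise (hence uniformly) on $I$, such that for all $n\ge1$ $$\sup_{0<\epsilon\le1} n\,a_n^{-p}\,\mathbb E\left[|\bar X_{\epsilon,n}(s,t)|^p\right]\le\{F_n(t)-F_n(s)\}^{\gamma}\qquad\text{for all } s<t \text{ in } I,$$ $$\sup_{0<\epsilon\le1} n^2a_n^{-2p}\,\mathbb E\left[|\bar X_{\epsilon,n}(s,t)|^p\,|\bar X_{\epsilon,n}(t,u)|^p\right]\le\{F_n(u)-F_n(s)\}^{2\gamma}\qquad\text{for all } s<t<u \text{ in } I.$$ Let $$U_{\epsilon,n}(t)=a_n^{-1}\sum_{i=1}^n\left\{X_i(t)\mathbf 1_{\{\|X_i\|_I\le a_n\epsilon\}}-\mathbb E\left[X_i(t)\mathbf 1_{\{\|X_i\|_I\le a_n\epsilon\}}\right]\right\},\qquad t\in I.$$ Then, for all $\eta>0$, $$\lim_{\epsilon\downarrow0}\limsup_{n\to\infty}\mathbb P\left(\|U_{\epsilon,n}\|_I>\eta\right)=0.$$ -/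

import Mathlib

open Set Filter Topology MeasureTheory ProbabilityTheory

noncomputable section

/-- The space `D_I` of real valued càdlàg functions on the compact interval `I = [l, r]`.
At the left end point `l` the filter of left limits is trivial, so that nothing is required there
from the left; at the right end point `r` nothing is required from the right. -/
structure CadlagSpace (l r : ℝ) where
  toFun : Icc l r → ℝ
  rightCont : ∀ t, ContinuousWithinAt toFun (Ici t) t
  leftLim : ∀ t, ∃ y, Tendsto toFun (𝓝[<] t) (𝓝 y)

namespace CadlagSpace

variable {l r : ℝ}

instance : CoeFun (CadlagSpace l r) (fun _ => Icc l r → ℝ) := ⟨CadlagSpace.toFun⟩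

/-- `J1Close δ x y` : there is an increasing homeomorphism `lam` of `I` onto itself (for an
interval this is the same as an order automorphism) with `‖lam - id‖ ≤ δ` and
`‖x - y ∘ lam‖ ≤ δ`. Skorokhod's `J₁` distance of `x` and `y` is the infimum of all such `δ`. -/
def J1Close (δ : ℝ) (x y : CadlagSpace l r) : Prop :=
  ∃ lam : Icc l r ≃o Icc l r,
    (∀ t, |(lam t : ℝ) - (t : ℝ)| ≤ δ) ∧ (∀ t, |x t - y (lam t)| ≤ δ)

/-- Skorokhod's `J₁` topology, i.e. the topology of the `J₁` distance: a set is open if with each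
of its points it contains a `J₁` ball around that point. -/
instance : TopologicalSpace (CadlagSpace l r) where
  IsOpen U := ∀ x ∈ U, ∃ δ > 0, ∀ y, J1Close δ x y → y ∈ U
  isOpen_univ := fun _ _ => ⟨1, one_pos, fun _ _ => mem_univ _⟩
  isOpen_inter := by
    rintro U V hU hV x ⟨hxU, hxV⟩
    obtain ⟨δ₁, h₁, H₁⟩ := hU x hxU
    obtain ⟨δ₂, h₂, H₂⟩ := hV x hxV
    refine ⟨min δ₁ δ₂, lt_min h₁ h₂, fun y ⟨lam, hl, hy⟩ => ⟨H₁ y ?_, H₂ y ?_⟩⟩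
    · exact ⟨lam, fun t => (hl t).trans (min_le_left _ _), fun t => (hy t).trans (min_le_left _ _)⟩
    · exact ⟨lam, fun t => (hl t).trans (min_le_right _ _),
        fun t => (hy t).trans (min_le_right _ _)⟩
  isOpen_sUnion := by
    rintro S hS x ⟨U, hU, hxU⟩
    obtain ⟨δ, hδ, H⟩ := hS U hU x hxU
    exact ⟨δ, hδ, fun y hy => ⟨U, hU, H y hy⟩⟩

/-- The Borel σ-field of the `J₁` topology. -/
instance : MeasurableSpace (CadlagSpace l r) := borel _

instance : BorelSpace (CadlagSpace l r) := ⟨rfl⟩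

end CadlagSpace

/-- The sup norm `‖x‖_I = sup_{t ∈ I} |x(t)|`; it is applied to bounded functions only (càdlàg
functions on a compact interval are bounded). -/
def supNorm {l r : ℝ} (x : Icc l r → ℝ) : ℝ := ⨆ t, |x t|

/-- The real random variable `Y` has a regularly varying right tail of index `α`:
`P(Y > c x) / P(Y > x) → c ^ (-α)` as `x → ∞`, for all `c > 0`. (As the limit is not zero,
`P(Y > x)` is positive for all `x`.) -/
def HasRegularlyVaryingTail {Ω : Type*} [MeasurableSpace Ω] (μ : Measure Ω) (Y : Ω → ℝ)
    (α : ℝ) : Prop :=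
  ∀ c : ℝ, 0 < c →
    Tendsto (fun x : ℝ => μ.real {ω | c * x < Y ω} / μ.real {ω | x < Y ω}) atTop (𝓝 (c ^ (-α)))

section Truncation

variable {Ω : Type*} [MeasurableSpace Ω] {l r : ℝ}

open Classical in
/-- The truncated process `t ↦ X(t) 1{‖X‖_I ≤ u}`. -/
def truncated (X : Ω → CadlagSpace l r) (u : ℝ) (ω : Ω) (t : Icc l r) : ℝ :=
  if supNorm (X ω) ≤ u then X ω t else 0

/-- The centered truncated increment
`{X(t) - X(s)} 1{‖X‖_I ≤ u} - E[{X(t) - X(s)} 1{‖X‖_I ≤ u}]`. -/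
def centeredIncrement (μ : Measure Ω) (X : Ω → CadlagSpace l r) (u : ℝ) (s t : Icc l r)
    (ω : Ω) : ℝ :=
  (truncated X u ω t - truncated X u ω s) - ∫ ω', (truncated X u ω' t - truncated X u ω' s) ∂μ

/-- The truncated, centered and normalized sum
`U_{ε,n} = a_n⁻¹ ∑_{i=1}^n (X_i 1{‖X_i‖_I ≤ a_n ε} - E[X_i 1{‖X_i‖_I ≤ a_n ε}])`,
where the expectation is taken pointwise in `t`. -/
def truncatedSum (μ : Measure Ω) (X : ℕ → Ω → CadlagSpace l r) (a : ℕ → ℝ) (ε : ℝ) (n : ℕ)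
    (ω : Ω) (t : Icc l r) : ℝ :=
  (a n)⁻¹ * ∑ i ∈ Finset.Icc 1 n,
    (truncated (X i) (a n * ε) ω t - ∫ ω', truncated (X i) (a n * ε) ω' t ∂μ)

end Truncation

end

/-! Write `U` for the truncated sum and fix a grid in `I`. If `‖U‖ > η`, then either `|U| ≥ η/2` at
a grid point, or some `t` in a cell has `U(t)` further than `η/2` from the values at both ends of
the cell.

At a grid point, Chebyshev's inequality leaves a multiple of `n a_n⁻² E[‖X‖² 1{‖X‖ ≤ a_n ε}]`. As `α
< 2`, Karamata's bound (`HasRegularlyVaryingTail.exists_truncated_second_moment_le`) replaces it by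
a multiple of `ε² n P(‖X‖ > a_n ε)`. This tends to a multiple of `ε^(2-α)` as `n → ∞`, which
vanishes with `ε`.

In a cell, Billingsley's maximal inequality (`measureReal_exists_le_of_product_bound`) needs only a
bound of order `(F_n(u) - F_n(s))^(2γ)` on the mixed `p`-th moment of two adjacent increments, where
`2γ > 1`. The product of two sums splits into two off-diagonal sums and a diagonal one
(`integral_abs_sum_rpow_mul_abs_sum_rpow_le`). The off-diagonal sums are martingales, handled by a
von Bahr-Esseen argument and the single-increment hypothesis; the diagonal is what the product
hypothesis controls. Summed over the cells, the bounds tend to a multiple of `∑ (ΔF)^(2γ)`, which is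
small on a fine grid because `F` is continuous. None of this depends on `ε`, so the grid can be
fixed before `ε`. -/

noncomputable section

/-! ### Boundedness of càdlàg paths; Borel measurability of the norm and of evaluations. -/

namespace CadlagSpace

variable {l r : ℝ}

theorem bddAbove_range_abs (x : CadlagSpace l r) : BddAbove (range fun t => |x t|) := by
  have h : ∃ C, ∀ t ∈ (univ : Set (Icc l r)), |x t| ≤ C := by
    refine isCompact_univ.induction_on (p := fun s => ∃ C, ∀ t ∈ s, |x t| ≤ C)
      ⟨0, by simp⟩ ?_ ?_ ?_
    · rintro s t hst ⟨C, hC⟩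
      exact ⟨C, fun u hu => hC u (hst hu)⟩
    · rintro s t ⟨C, hC⟩ ⟨D, hD⟩
      refine ⟨max C D, fun u hu => ?_⟩
      rcases hu with hu | hu
      · exact (hC u hu).trans (le_max_left _ _)
      · exact (hD u hu).trans (le_max_right _ _)
    · intro t _
      obtain ⟨y, hy⟩ := x.leftLim t
      have h1 : ∀ᶠ s in 𝓝[<] t, |x s| < |y| + 1 :=
        hy.abs.eventually_lt_const (by linarith)
      have h2 : ∀ᶠ s in 𝓝[≥] t, |x s| < |x t| + 1 :=
        (x.rightCont t).tendsto.abs.eventually_lt_const (by linarith)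
      refine ⟨{s | |x s| ≤ max (|y| + 1) (|x t| + 1)}, ?_, _, fun s hs => hs⟩
      rw [nhdsWithin_univ, ← nhdsLT_sup_nhdsGE]
      exact mem_sup.2 ⟨h1.mono fun s hs => hs.le.trans (le_max_left _ _),
        h2.mono fun s hs => hs.le.trans (le_max_right _ _)⟩
  obtain ⟨C, hC⟩ := h
  exact ⟨C, by rintro _ ⟨t, rfl⟩; exact hC t (mem_univ t)⟩

theorem abs_le_supNorm (x : CadlagSpace l r) (t : Icc l r) : |x t| ≤ supNorm x :=
  le_ciSup x.bddAbove_range_abs t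

theorem isOpen_iff {U : Set (CadlagSpace l r)} :
    IsOpen U ↔ ∀ x ∈ U, ∃ δ > 0, ∀ y, J1Close δ x y → y ∈ U := Iff.rfl

/-- A time change does not alter the sup norm, so `J₁` closeness `δ` moves the norm by at most `δ`.
-/
theorem measurable_supNorm : Measurable fun x : CadlagSpace l r => supNorm x := by
  refine measurable_of_Iio fun c => IsOpen.measurableSet (isOpen_iff.2 fun x hx => ?_)
  have hx : supNorm x < c := hx
  refine ⟨(c - supNorm x) / 2, by linarith, fun y ⟨lam, _, hy⟩ => ?_⟩
  have h0 : 0 ≤ supNorm x := Real.iSup_nonneg fun t => abs_nonneg _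
  have : supNorm y ≤ supNorm x + (c - supNorm x) / 2 := by
    refine Real.iSup_le (fun t => ?_) (by linarith)
    have h1 := hy (lam.symm t)
    rw [OrderIso.apply_symm_apply] at h1
    have h2 := x.abs_le_supNorm (lam.symm t)
    have h3 := abs_sub_abs_le_abs_sub (y t) (x (lam.symm t))
    rw [abs_sub_comm] at h3
    linarith
  change supNorm y < c
  linarith

/-- Evaluation at a time before `r` is not `J₁` continuous, but exceeding a level somewhere in an
open time window survives small shifts of time and space. -/
theorem isOpen_exists_lt (t : Icc l r) (u c : ℝ) :
    IsOpen {x : CadlagSpace l r | ∃ s, t < s ∧ (s : ℝ) < u ∧ c < x s} := by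
  refine isOpen_iff.2 fun x ⟨s, hts, hsu, hc⟩ => ?_
  have hts' : (t : ℝ) < s := hts
  refine ⟨min (x s - c) (min (u - s) (s - t)) / 2,
    half_pos (lt_min (by linarith) (lt_min (by linarith) (by linarith))), ?_⟩
  rintro y ⟨lam, hl, hy⟩
  have h0 : 0 < min (x s - c) (min (u - s) (s - t)) :=
    lt_min (by linarith) (lt_min (by linarith) (by linarith))
  have h1 : min (x s - c) (min (u - s) (s - t)) ≤ x s - c := min_le_left _ _
  have h2 : min (x s - c) (min (u - s) (s - t)) ≤ u - s :=
    (min_le_right _ _).trans (min_le_left _ _)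
  have h3 : min (x s - c) (min (u - s) (s - t)) ≤ s - t :=
    (min_le_right _ _).trans (min_le_right _ _)
  have hl' := abs_le.1 (hl s)
  have hy' := abs_le.1 (hy s)
  refine ⟨lam s, ?_, ?_, ?_⟩
  · have : (t : ℝ) < lam s := by linarith
    exact this
  · linarith
  · linarith

/-- Every order automorphism of the interval fixes `r`, so evaluation there is continuous. -/
theorem isOpen_lt_right_endpoint {t : Icc l r} (ht : (t : ℝ) = r) (c : ℝ) :
    IsOpen {x : CadlagSpace l r | x t < c} := by
  refine isOpen_iff.2 fun x hx => ?_
  have hx : x t < c := hx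
  refine ⟨(c - x t) / 2, by linarith, fun y ⟨lam, _, hy⟩ => ?_⟩
  have hlam : lam t = t := by
    refine le_antisymm ?_ ?_
    · change (lam t : ℝ) ≤ t
      rw [ht]; exact (lam t).2.2
    · have h1 : lam.symm t ≤ t := by
        change (lam.symm t : ℝ) ≤ t
        rw [ht]; exact (lam.symm t).2.2
      simpa using lam.monotone h1
  have h := hy t
  rw [hlam] at h
  have := abs_le.1 h
  change y t < c
  linarith

/-- By right continuity the value at `t` is determined by the values at times just after `t`; this
exhibits the event as a countable intersection of open sets. -/
theorem eval_ge_eq_iInter {t : Icc l r} (ht : (t : ℝ) < r) (c : ℝ) :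
    {x : CadlagSpace l r | c ≤ x t} = ⋂ n : ℕ, {x : CadlagSpace l r |
      ∃ s, t < s ∧ (s : ℝ) < t + 1 / ((n : ℝ) + 1) ∧ c - 1 / ((n : ℝ) + 1) < x s} := by
  have hlim := tendsto_one_div_add_atTop_nhds_zero_nat (𝕜 := ℝ)
  ext x
  simp only [mem_ofPred_eq, mem_iInter]
  constructor
  · intro hc n
    have hn : (0 : ℝ) < 1 / ((n : ℝ) + 1) := by positivity
    have h1 : ∀ᶠ s in 𝓝[>] t, c - 1 / ((n : ℝ) + 1) < x s :=
      ((x.rightCont t).tendsto.mono_left (nhdsWithin_mono _ Ioi_subset_Ici_self)).eventually_const_lt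
        (by linarith)
    have hval : Tendsto (fun s : Icc l r => (s : ℝ)) (𝓝[>] t) (𝓝 (t : ℝ)) :=
      (continuous_subtype_val.tendsto t).mono_left nhdsWithin_le_nhds
    have h2 : ∀ᶠ s : Icc l r in 𝓝[>] t, (s : ℝ) < t + 1 / ((n : ℝ) + 1) :=
      hval.eventually_lt_const (by linarith)
    have : (𝓝[>] t).NeBot :=
      nhdsGT_neBot_of_exists_gt ⟨⟨r, t.2.1.trans t.2.2, le_rfl⟩, ht⟩
    obtain ⟨s, ⟨hs1, hs2⟩, hs3⟩ := ((h1.and h2).and self_mem_nhdsWithin).exists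
    exact ⟨s, hs3, hs2, hs1⟩
  · intro h
    choose s hs1 hs2 hs3 using h
    have hs : Tendsto s atTop (𝓝[≥] t) := by
      refine tendsto_nhdsWithin_iff.2 ⟨?_, Eventually.of_forall fun n => (hs1 n).le⟩
      rw [tendsto_subtype_rng]
      refine tendsto_of_tendsto_of_tendsto_of_le_of_le tendsto_const_nhds
        (by simpa using tendsto_const_nhds.add hlim) (fun n => (hs1 n).le) (fun n => (hs2 n).le)
    have hx := (x.rightCont t).tendsto.comp hs
    have hc : Tendsto (fun n : ℕ => c - 1 / ((n : ℝ) + 1)) atTop (𝓝 c) := by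
      simpa using tendsto_const_nhds.sub hlim
    exact le_of_tendsto_of_tendsto' hc hx fun n => (hs3 n).le

theorem measurable_eval (t : Icc l r) : Measurable fun x : CadlagSpace l r => x t := by
  rcases t.2.2.lt_or_eq with ht | ht
  · refine measurable_of_Ici fun c => ?_
    change MeasurableSet {x : CadlagSpace l r | c ≤ x t}
    rw [eval_ge_eq_iInter ht]
    exact MeasurableSet.iInter fun n => (isOpen_exists_lt _ _ _).measurableSet
  · exact measurable_of_Iio fun c => (isOpen_lt_right_endpoint ht c).measurableSet

/-- The truncation of a càdlàg function, evaluated at `t`. -/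
def trunc (u : ℝ) (t : Icc l r) (x : CadlagSpace l r) : ℝ := truncated id u x t

theorem measurable_trunc (u : ℝ) (t : Icc l r) : Measurable (trunc (l := l) (r := r) u t) :=
  Measurable.ite (measurableSet_le measurable_supNorm measurable_const) (measurable_eval t)
    measurable_const

theorem supNorm_nonneg (x : Icc l r → ℝ) : 0 ≤ supNorm x := Real.iSup_nonneg fun _ => abs_nonneg _

theorem abs_trunc_le_indicator (u : ℝ) (t : Icc l r) (x : CadlagSpace l r) :
    |trunc u t x| ≤ if supNorm x ≤ u then supNorm x else 0 := by
  unfold trunc truncated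
  simp only [id]
  split_ifs
  · exact x.abs_le_supNorm t
  · simp

theorem abs_trunc_le (u : ℝ) (t : Icc l r) (x : CadlagSpace l r) : |trunc u t x| ≤ |u| := by
  refine (abs_trunc_le_indicator u t x).trans ?_
  split_ifs with h
  · exact h.trans (le_abs_self u)
  · positivity

theorem continuousWithinAt_trunc (u : ℝ) (x : CadlagSpace l r) (t : Icc l r) :
    ContinuousWithinAt (fun s => trunc u s x) (Ici t) t := by
  unfold trunc truncated
  simp only [id]
  split_ifs
  · exact x.rightCont t
  · exact continuousWithinAt_const

end CadlagSpace

/-! ### Elementary inequalities for powers with exponent in `(1, 2]`. -/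

section PowerInequalities

variable {p : ℝ}

theorem abs_rpow_sub_two_mul_of_nonneg (hp : 1 < p) {x : ℝ} (hx : 0 ≤ x) :
    |x| ^ (p - 2) * x = x ^ (p - 1) := by
  rcases hx.eq_or_lt with rfl | hx
  · rw [mul_zero, Real.zero_rpow (by linarith)]
  · rw [abs_of_pos hx, ← Real.rpow_add_one hx.ne']
    congr 1; ring

theorem abs_rpow_sub_two_mul_of_nonpos (hp : 1 < p) {x : ℝ} (hx : x ≤ 0) :
    |x| ^ (p - 2) * x = -(-x) ^ (p - 1) := by
  have := abs_rpow_sub_two_mul_of_nonneg hp (neg_nonneg.2 hx)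
  rw [abs_neg] at this
  linarith

theorem rpow_sub_rpow_le {r x y : ℝ} (hr : 0 ≤ r) (hr1 : r ≤ 1) (hy : 0 ≤ y) (hyx : y ≤ x) :
    |x ^ r - y ^ r| ≤ (x - y) ^ r := by
  have h := Real.rpow_add_le_add_rpow (sub_nonneg.2 hyx) hy hr hr1
  rw [sub_add_cancel] at h
  rw [abs_of_nonneg (sub_nonneg.2 (Real.rpow_le_rpow hy hyx hr))]
  linarith

theorem abs_rpow_sub_rpow_le {r x y : ℝ} (hr : 0 ≤ r) (hr1 : r ≤ 1) (hx : 0 ≤ x) (hy : 0 ≤ y) :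
    |x ^ r - y ^ r| ≤ |x - y| ^ r := by
  rcases le_total y x with h | h
  · rw [abs_of_nonneg (sub_nonneg.2 h)]
    exact rpow_sub_rpow_le hr hr1 hy h
  · rw [abs_sub_comm, abs_sub_comm x y, abs_of_nonneg (sub_nonneg.2 h)]
    exact rpow_sub_rpow_le hr hr1 hx h

/-- The odd power `x ↦ |x| ^ (p - 2) * x` is Hölder continuous with exponent `p - 1`. -/
theorem abs_oddPow_sub_le (hp : 1 < p) (hp2 : p ≤ 2) (x y : ℝ) :
    |(|x| ^ (p - 2) * x) - |y| ^ (p - 2) * y| ≤ 2 * |x - y| ^ (p - 1) := by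
  have hr : 0 ≤ p - 1 := by linarith
  have hr1 : p - 1 ≤ 1 := by linarith
  have hpos : 0 ≤ |x - y| ^ (p - 1) := by positivity
  rcases le_total 0 x with hx | hx <;> rcases le_total 0 y with hy | hy
  · rw [abs_rpow_sub_two_mul_of_nonneg hp hx, abs_rpow_sub_two_mul_of_nonneg hp hy]
    linarith [abs_rpow_sub_rpow_le hr hr1 hx hy]
  · rw [abs_rpow_sub_two_mul_of_nonneg hp hx, abs_rpow_sub_two_mul_of_nonpos hp hy]
    have h1 : x ^ (p - 1) ≤ |x - y| ^ (p - 1) :=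
      Real.rpow_le_rpow hx (by rw [abs_of_nonneg] <;> linarith) hr
    have h2 : (-y) ^ (p - 1) ≤ |x - y| ^ (p - 1) :=
      Real.rpow_le_rpow (by linarith) (by rw [abs_of_nonneg] <;> linarith) hr
    have h3 : 0 ≤ x ^ (p - 1) := by positivity
    have h4 : 0 ≤ (-y) ^ (p - 1) := Real.rpow_nonneg (by linarith) _
    rw [abs_of_nonneg] <;> linarith
  · rw [abs_rpow_sub_two_mul_of_nonpos hp hx, abs_rpow_sub_two_mul_of_nonneg hp hy]
    have h1 : (-x) ^ (p - 1) ≤ |x - y| ^ (p - 1) :=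
      Real.rpow_le_rpow (by linarith) (by rw [abs_of_nonpos] <;> linarith) hr
    have h2 : y ^ (p - 1) ≤ |x - y| ^ (p - 1) :=
      Real.rpow_le_rpow hy (by rw [abs_of_nonpos] <;> linarith) hr
    have h3 : 0 ≤ y ^ (p - 1) := by positivity
    have h4 : 0 ≤ (-x) ^ (p - 1) := Real.rpow_nonneg (by linarith) _
    rw [abs_of_nonpos] <;> linarith
  · rw [abs_rpow_sub_two_mul_of_nonpos hp hx, abs_rpow_sub_two_mul_of_nonpos hp hy]
    have := abs_rpow_sub_rpow_le hr hr1 (neg_nonneg.2 hx) (neg_nonneg.2 hy)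
    rw [← abs_neg (x - y)]
    rw [← abs_neg] at this ⊢
    rw [show -(-(-x) ^ (p - 1) - -(-y) ^ (p - 1)) = (-x) ^ (p - 1) - (-y) ^ (p - 1) by ring,
      show -(x - y) = -x - -y by ring]
    rw [abs_neg] at this
    have h0 : 0 ≤ |-x - -y| ^ (p - 1) := by positivity
    linarith

/-- Mean value theorem for `s ↦ |a + s b|^p`: replacing the derivative at the intermediate point by
the one at `0` costs at most `2p |b|^p`, by the Hölder bound `abs_oddPow_sub_le`, and `2p ≤ 4`. -/
theorem abs_add_rpow_le_taylor (hp : 1 < p) (hp2 : p ≤ 2) (a b : ℝ) :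
    |a + b| ^ p ≤ |a| ^ p + p * ((|a| ^ (p - 2) * a) * b) + 4 * |b| ^ p := by
  have hd : ∀ s : ℝ, HasDerivAt (fun s : ℝ => |a + s * b| ^ p)
      (p * |a + s * b| ^ (p - 2) * (a + s * b) * b) s := fun s => by
    have h1 : HasDerivAt (fun s : ℝ => a + s * b) b s := by
      simpa using ((hasDerivAt_id s).mul_const b).const_add a
    exact (hasDerivAt_abs_rpow (a + s * b) hp).comp s h1
  obtain ⟨c, hc, h⟩ := exists_hasDerivAt_eq_slope _ _ (zero_lt_one' ℝ)
    (fun s _ => (hd s).continuousAt.continuousWithinAt) (fun s _ => hd s)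
  simp only [one_mul, zero_mul, add_zero, sub_zero, div_one] at h
  have hH := abs_oddPow_sub_le hp hp2 (a + c * b) a
  rw [add_sub_cancel_left, abs_mul, abs_of_pos hc.1] at hH
  have h1 : (c * |b|) ^ (p - 1) ≤ |b| ^ (p - 1) :=
    Real.rpow_le_rpow (by have := hc.1; positivity)
      (mul_le_of_le_one_left (abs_nonneg b) hc.2.le) (by linarith)
  have h2 : |b| ^ (p - 1) * |b| = |b| ^ p := by
    rcases eq_or_ne b 0 with rfl | hb
    · simp [Real.zero_rpow (by linarith : p ≠ 0)]
    · rw [← Real.rpow_add_one (abs_pos.2 hb).ne']; congr 1; ring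
  have h3 : (|a + c * b| ^ (p - 2) * (a + c * b) - |a| ^ (p - 2) * a) * b
      ≤ 2 * |b| ^ p := by
    rw [← h2]
    calc _ ≤ |(|a + c * b| ^ (p - 2) * (a + c * b) - |a| ^ (p - 2) * a)| * |b| := by
          rw [← abs_mul]; exact le_abs_self _
      _ ≤ (2 * |b| ^ (p - 1)) * |b| := by gcongr; linarith
      _ = _ := by ring
  have h4 : 0 ≤ |b| ^ p := by positivity
  nlinarith

theorem abs_add_add_rpow_le (hp : 0 ≤ p) (hp2 : p ≤ 2) (x y z : ℝ) :
    |x + y + z| ^ p ≤ 9 * (|x| ^ p + |y| ^ p + |z| ^ p) := by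
  obtain ⟨w, hw, hw0, hwp⟩ : ∃ w : ℝ, |x + y + z| ≤ 3 * w ∧ 0 ≤ w ∧
      w ^ p ≤ |x| ^ p + |y| ^ p + |z| ^ p := by
    have hx : 0 ≤ |x| ^ p := by positivity
    have hy : 0 ≤ |y| ^ p := by positivity
    have hz : 0 ≤ |z| ^ p := by positivity
    have h := (abs_add_le (x + y) z).trans (add_le_add_left (abs_add_le x y) _)
    rcases le_total |x| |y| with h1 | h1 <;> rcases le_total |y| |z| with h2 | h2 <;>
      rcases le_total |x| |z| with h3 | h3
    all_goals first
      | exact ⟨|x|, by linarith, abs_nonneg _, by linarith⟩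
      | exact ⟨|y|, by linarith, abs_nonneg _, by linarith⟩
      | exact ⟨|z|, by linarith, abs_nonneg _, by linarith⟩
  have h3 : (3 : ℝ) ^ p ≤ 9 := by
    calc (3 : ℝ) ^ p ≤ 3 ^ (2 : ℝ) := Real.rpow_le_rpow_of_exponent_le (by norm_num) hp2
      _ = 9 := by norm_num
  calc |x + y + z| ^ p ≤ (3 * w) ^ p := Real.rpow_le_rpow (abs_nonneg _) hw hp
    _ = 3 ^ p * w ^ p := Real.mul_rpow (by norm_num) hw0
    _ ≤ 9 * (|x| ^ p + |y| ^ p + |z| ^ p) := by gcongr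

end PowerInequalities

/-! ### Bounded measurable functions, for which integrability is automatic. -/

section BoundedMeasurable

variable {Ω : Type*} [mΩ : MeasurableSpace Ω]

/-- Bounded measurable real functions. -/
def BddMeasurable (f : Ω → ℝ) : Prop := Measurable f ∧ ∃ C, ∀ ω, |f ω| ≤ C

namespace BddMeasurable

variable {f g : Ω → ℝ}

theorem const (c : ℝ) : BddMeasurable (fun _ : Ω => c) := ⟨measurable_const, |c|, fun _ => le_rfl⟩

theorem add (hf : BddMeasurable f) (hg : BddMeasurable g) :
    BddMeasurable (fun ω => f ω + g ω) := by
  obtain ⟨hf, C, hC⟩ := hf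
  obtain ⟨hg, D, hD⟩ := hg
  exact ⟨hf.add hg, C + D, fun ω => (abs_add_le _ _).trans (add_le_add (hC ω) (hD ω))⟩

theorem mul (hf : BddMeasurable f) (hg : BddMeasurable g) :
    BddMeasurable (fun ω => f ω * g ω) := by
  obtain ⟨hf, C, hC⟩ := hf
  obtain ⟨hg, D, hD⟩ := hg
  refine ⟨hf.mul hg, C * D, fun ω => ?_⟩
  rw [abs_mul]
  exact mul_le_mul (hC ω) (hD ω) (abs_nonneg _) ((abs_nonneg _).trans (hC ω))

theorem sub (hf : BddMeasurable f) (hg : BddMeasurable g) :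
    BddMeasurable (fun ω => f ω - g ω) := by
  simpa [sub_eq_add_neg] using hf.add ((const (-1)).mul hg)

theorem sum {ι : Type*} (s : Finset ι) {f : ι → Ω → ℝ} (hf : ∀ i ∈ s, BddMeasurable (f i)) :
    BddMeasurable (fun ω => ∑ i ∈ s, f i ω) := by
  classical
  induction s using Finset.induction_on with
  | empty => simpa using const 0
  | insert a s ha ih =>
    simp only [Finset.sum_insert ha]
    exact (hf a (by simp)).add (ih fun i hi => hf i (by simp [hi]))

theorem abs_rpow (hf : BddMeasurable f) {p : ℝ} (hp : 0 ≤ p) :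
    BddMeasurable (fun ω => |f ω| ^ p) := by
  obtain ⟨hf, C, hC⟩ := hf
  refine ⟨hf.abs.pow_const p, C ^ p, fun ω => ?_⟩
  rw [abs_of_nonneg (by positivity)]
  exact Real.rpow_le_rpow (abs_nonneg _) (hC ω) hp

theorem oddPow (hf : BddMeasurable f) {p : ℝ} (hp : 1 < p) (hp2 : p ≤ 2) :
    BddMeasurable (fun ω => |f ω| ^ (p - 2) * f ω) := by
  obtain ⟨hf, C, hC⟩ := hf
  refine ⟨(hf.abs.pow_const _).mul hf, 2 * C ^ (p - 1), fun ω => ?_⟩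
  have h := abs_oddPow_sub_le hp hp2 (f ω) 0
  simp only [mul_zero, sub_zero] at h
  have := Real.rpow_le_rpow (abs_nonneg _) (hC ω) (by linarith : 0 ≤ p - 1)
  linarith

theorem comp {E : Type*} [MeasurableSpace E] {h : E → ℝ} (hh : BddMeasurable h) {W : Ω → E}
    (hW : Measurable W) : BddMeasurable (fun ω => h (W ω)) := by
  obtain ⟨hh, C, hC⟩ := hh
  exact ⟨hh.comp hW, C, fun ω => hC _⟩

theorem integrable (hf : BddMeasurable f) (μ : Measure Ω) [IsFiniteMeasure μ] :
    Integrable f μ := by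
  obtain ⟨hf, C, hC⟩ := hf
  exact Integrable.of_bound hf.aestronglyMeasurable C (Eventually.of_forall fun ω => hC ω)

end BddMeasurable

end BoundedMeasurable

/-! ### Moments of order `p` of sums and products of sums of i.i.d. centered variables. -/

section Moments

variable {Ω : Type*} {m mΩ : MeasurableSpace Ω} {μ : Measure Ω} {p : ℝ}

/-- One step of the von Bahr-Esseen inequality: `z` is centered and independent of a `σ`-field for
which `A` and `S` are measurable. -/
theorem integral_abs_add_mul_rpow_le [IsFiniteMeasure μ] (hp : 1 < p) (hp2 : p ≤ 2)
    {A S z : Ω → ℝ} (hA : BddMeasurable A) (hS : BddMeasurable S) (hz : BddMeasurable z)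
    (hAm : Measurable[m] A) (hSm : Measurable[m] S)
    (hind : Indep (MeasurableSpace.comap z inferInstance) m μ) (hz0 : ∫ ω, z ω ∂μ = 0) :
    ∫ ω, |A ω + z ω * S ω| ^ p ∂μ
      ≤ ∫ ω, |A ω| ^ p ∂μ + 4 * ((∫ ω, |z ω| ^ p ∂μ) * ∫ ω, |S ω| ^ p ∂μ) := by
  have hp0 : 0 ≤ p := by linarith
  have hindep : ∀ h : Ω → ℝ, Measurable[m] h → IndepFun z h μ := fun h hh => by
    rw [IndepFun_iff_Indep]
    exact indep_of_indep_of_le_right hind hh.comap_le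
  -- The first-order Taylor term has mean zero, as `z` is centered and independent of `A` and `S`.
  have hcross : ∫ ω, (|A ω| ^ (p - 2) * A ω) * (z ω * S ω) ∂μ = 0 := by
    have hm : Measurable[m] (fun ω => (|A ω| ^ (p - 2) * A ω) * S ω) :=
      (((measurable_norm.comp hAm).pow_const (p - 2)).mul hAm).mul hSm
    have h := (hindep _ hm).integral_fun_mul_eq_mul_integral
      hz.1.aestronglyMeasurable (((hA.oddPow hp hp2).mul hS).1.aestronglyMeasurable)
    rw [hz0, zero_mul] at h
    rw [← h]
    exact integral_congr_ae (Eventually.of_forall fun ω => by ring)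
  have hprod : ∫ ω, |z ω * S ω| ^ p ∂μ = (∫ ω, |z ω| ^ p ∂μ) * ∫ ω, |S ω| ^ p ∂μ := by
    have h := ((hindep S hSm).comp (φ := fun x : ℝ => |x| ^ p) (ψ := fun x : ℝ => |x| ^ p)
      (measurable_norm.pow_const p) (measurable_norm.pow_const p)).integral_fun_mul_eq_mul_integral
      (hz.abs_rpow hp0).1.aestronglyMeasurable (hS.abs_rpow hp0).1.aestronglyMeasurable
    simp only [Function.comp] at h
    rw [← h]
    exact integral_congr_ae (Eventually.of_forall fun ω => by
      simp only [abs_mul]; exact Real.mul_rpow (abs_nonneg _) (abs_nonneg _))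
  have hB := hz.mul hS
  have i1 := (hA.abs_rpow hp0).integrable μ
  have i2 := (((BddMeasurable.const p).mul ((hA.oddPow hp hp2).mul hB))).integrable μ
  have i12 : Integrable (fun ω => |A ω| ^ p + p * ((|A ω| ^ (p - 2) * A ω) * (z ω * S ω))) μ :=
    i1.add i2
  have i3 := ((BddMeasurable.const 4).mul (hB.abs_rpow hp0)).integrable μ
  calc ∫ ω, |A ω + z ω * S ω| ^ p ∂μ
      ≤ ∫ ω, (|A ω| ^ p + p * ((|A ω| ^ (p - 2) * A ω) * (z ω * S ω)) + 4 * |z ω * S ω| ^ p) ∂μ :=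
        integral_mono ((hA.add hB).abs_rpow hp0 |>.integrable μ) (i12.add i3)
          fun ω => abs_add_rpow_le_taylor hp hp2 _ _
    _ = _ := by
        rw [integral_add i12 i3, integral_add i1 i2, integral_const_mul,
          integral_const_mul, hcross, hprod]
        ring

variable {E : Type*} [MeasurableSpace E] {W : ℕ → Ω → E} {f g : E → ℝ}

theorem indep_comap_iSup_lt (hW : ∀ i, Measurable (W i)) (hind : iIndepFun W μ)
    (hf : Measurable f) (j : ℕ) :
    Indep (MeasurableSpace.comap (fun ω => f (W j ω)) inferInstance)
      (⨆ i ∈ Iio j, MeasurableSpace.comap (W i) inferInstance) μ := by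
  have h := indep_iSup_of_disjoint (fun i => (hW i).comap_le) hind
    (S := {j}) (T := Iio j) (by simp)
  refine indep_of_indep_of_le_left h ?_
  have h1 : MeasurableSpace.comap (fun ω => f (W j ω)) inferInstance
      ≤ MeasurableSpace.comap (W j) inferInstance :=
    Measurable.comap_le (hf.comp (comap_measurable (W j)))
  refine h1.trans ?_
  exact le_iSup₂_of_le j (by simp) le_rfl

theorem measurable_iSup_lt (hf : Measurable f) {i j : ℕ} (hij : i < j) :
    Measurable[⨆ i ∈ Iio j, MeasurableSpace.comap (W i) inferInstance] (fun ω => f (W i ω)) := by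
  have h1 : Measurable[MeasurableSpace.comap (W i) inferInstance] (fun ω => f (W i ω)) :=
    hf.comp (comap_measurable (W i))
  exact h1.mono (le_iSup₂_of_le i hij le_rfl) le_rfl

theorem measurable_sum_iSup_lt (hf : Measurable f) {k j : ℕ} (hkj : k ≤ j) :
    Measurable[⨆ i ∈ Iio j, MeasurableSpace.comap (W i) inferInstance]
      (fun ω => ∑ i ∈ Finset.range k, f (W i ω)) := by
  refine @Finset.measurable_fun_sum _ _ _ _ _ _ (_) _ _ fun i hi => ?_
  exact measurable_iSup_lt hf ((Finset.mem_range.1 hi).trans_le hkj)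

variable {Y : Ω → E}

theorem integral_comp_eq (hid : ∀ i, IdentDistrib (W i) Y μ μ) (hf : Measurable f) (i : ℕ) :
    ∫ ω, f (W i ω) ∂μ = ∫ ω, f (Y ω) ∂μ :=
  ((hid i).comp hf).integral_eq

variable [IsProbabilityMeasure μ]

/-- The von Bahr-Esseen inequality: by the one-step bound with `S = 1`, each new summand adds at
most `4 E|f(Y)|^p`. -/
theorem integral_abs_sum_rpow_le (hp : 1 < p) (hp2 : p ≤ 2) (hW : ∀ i, Measurable (W i))
    (hind : iIndepFun W μ) (hid : ∀ i, IdentDistrib (W i) Y μ μ) (hf : BddMeasurable f)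
    (hf0 : ∫ ω, f (Y ω) ∂μ = 0) (n : ℕ) :
    ∫ ω, |∑ i ∈ Finset.range n, f (W i ω)| ^ p ∂μ ≤ 4 * (n * ∫ ω, |f (Y ω)| ^ p ∂μ) := by
  induction n with
  | zero => simp [Real.zero_rpow (by linarith : p ≠ 0)]
  | succ n ih =>
    have h := integral_abs_add_mul_rpow_le (μ := μ) hp hp2
      (A := fun ω => ∑ i ∈ Finset.range n, f (W i ω)) (S := fun _ => 1)
      (z := fun ω => f (W n ω)) (BddMeasurable.sum _ fun i _ => hf.comp (hW i))
      (BddMeasurable.const 1) (hf.comp (hW n)) (measurable_sum_iSup_lt hf.1 le_rfl)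
      measurable_const (indep_comap_iSup_lt hW hind hf.1 n)
      ((integral_comp_eq hid hf.1 n).trans hf0)
    have h2 := integral_comp_eq hid (f := fun x => |f x| ^ p)
      (hf.abs_rpow (by linarith)).1 n
    simp only [mul_one, abs_one, Real.one_rpow, integral_const, probReal_univ, smul_eq_mul,
      h2] at h
    simp only [Finset.sum_range_succ]
    push_cast
    linarith

/-- A martingale with increments `g(W_j) S_j`, where `S_j` is the sum of the earlier `f(W_i)`. The
`j`-th step costs `4 E|g|^p E|S_j|^p ≤ 16 j E|f|^p E|g|^p`, and `∑_{j<n} j ≤ n²`. -/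
theorem integral_abs_triangular_sum_rpow_le (hp : 1 < p) (hp2 : p ≤ 2)
    (hW : ∀ i, Measurable (W i)) (hind : iIndepFun W μ) (hid : ∀ i, IdentDistrib (W i) Y μ μ)
    (hf : BddMeasurable f) (hg : BddMeasurable g) (hf0 : ∫ ω, f (Y ω) ∂μ = 0)
    (hg0 : ∫ ω, g (Y ω) ∂μ = 0) (n : ℕ) :
    ∫ ω, |∑ j ∈ Finset.range n, g (W j ω) * ∑ i ∈ Finset.range j, f (W i ω)| ^ p ∂μ
      ≤ 16 * ((n : ℝ) ^ 2 * ((∫ ω, |f (Y ω)| ^ p ∂μ) * ∫ ω, |g (Y ω)| ^ p ∂μ)) := by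
  induction n with
  | zero => simp [Real.zero_rpow (by linarith : p ≠ 0)]
  | succ n ih =>
    have hS : ∀ k, BddMeasurable fun ω => ∑ i ∈ Finset.range k, f (W i ω) :=
      fun k => BddMeasurable.sum _ fun i _ => hf.comp (hW i)
    have h := integral_abs_add_mul_rpow_le (μ := μ) hp hp2
      (A := fun ω => ∑ j ∈ Finset.range n, g (W j ω) * ∑ i ∈ Finset.range j, f (W i ω))
      (S := fun ω => ∑ i ∈ Finset.range n, f (W i ω)) (z := fun ω => g (W n ω))
      (BddMeasurable.sum _ fun j _ => (hg.comp (hW j)).mul (hS j))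
      (hS n) (hg.comp (hW n))
      (@Finset.measurable_fun_sum _ _ _ _ _ _ (_) _ _ fun j hj =>
        (measurable_iSup_lt hg.1 (Finset.mem_range.1 hj)).mul
          (measurable_sum_iSup_lt hf.1 (Finset.mem_range.1 hj).le))
      (measurable_sum_iSup_lt hf.1 le_rfl) (indep_comap_iSup_lt hW hind hg.1 n)
      ((integral_comp_eq hid hg.1 n).trans hg0)
    have h1 := integral_abs_sum_rpow_le hp hp2 hW hind hid hf hf0 n
    have h2 := integral_comp_eq hid (f := fun x => |g x| ^ p)
      (hg.abs_rpow (by linarith)).1 n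
    simp only [h2] at h
    simp only [Finset.sum_range_succ]
    have hx : 0 ≤ ∫ ω, |f (Y ω)| ^ p ∂μ := integral_nonneg fun ω => by positivity
    have hy : 0 ≤ ∫ ω, |g (Y ω)| ^ p ∂μ := integral_nonneg fun ω => by positivity
    generalize ∫ ω, |f (Y ω)| ^ p ∂μ = x at *
    generalize ∫ ω, |g (Y ω)| ^ p ∂μ = y at *
    have h3 := mul_le_mul_of_nonneg_left h1 hy
    push_cast
    have hn : (0 : ℝ) ≤ n := n.cast_nonneg
    have h4 : 0 ≤ x * y := mul_nonneg hx hy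
    nlinarith [mul_nonneg hn h4]

/-- The double sum is sorted by which index is the larger, so that each off-diagonal part is a
martingale. -/
theorem sum_mul_sum_eq_triangular (x y : ℕ → ℝ) (n : ℕ) :
    (∑ i ∈ Finset.range n, x i) * ∑ i ∈ Finset.range n, y i =
      (∑ j ∈ Finset.range n, y j * ∑ i ∈ Finset.range j, x i) +
      (∑ j ∈ Finset.range n, x j * ∑ i ∈ Finset.range j, y i) +
      ∑ j ∈ Finset.range n, x j * y j := by
  induction n with
  | zero => simp
  | succ n ih =>
    simp only [Finset.sum_range_succ]
    linear_combination ih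

/-- Meant for the diagonal terms, which are not centered. Convexity alone gives the factor `n^(p-1)
· n ≤ n²`, and this is affordable because the product hypothesis carries `n²`. -/
theorem integral_abs_sum_mul_rpow_le (hp : 1 < p) (hp2 : p ≤ 2) (hW : ∀ i, Measurable (W i))
    (hid : ∀ i, IdentDistrib (W i) Y μ μ) (hf : BddMeasurable f) (n : ℕ) :
    ∫ ω, |∑ i ∈ Finset.range n, f (W i ω)| ^ p ∂μ ≤ (n : ℝ) ^ 2 * ∫ ω, |f (Y ω)| ^ p ∂μ := by
  have hp0 : 0 ≤ p := by linarith
  rcases Nat.eq_zero_or_pos n with rfl | hn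
  · simp [Real.zero_rpow (by linarith : p ≠ 0)]
  have hn1 : (1 : ℝ) ≤ n := by exact_mod_cast hn
  have hx : 0 ≤ ∫ ω, |f (Y ω)| ^ p ∂μ := integral_nonneg fun ω => by positivity
  have hterm : ∀ i, BddMeasurable fun ω => |f (W i ω)| ^ p :=
    fun i => (hf.comp (hW i)).abs_rpow hp0
  calc ∫ ω, |∑ i ∈ Finset.range n, f (W i ω)| ^ p ∂μ
      ≤ ∫ ω, (n : ℝ) ^ (p - 1) * ∑ i ∈ Finset.range n, |f (W i ω)| ^ p ∂μ := by
        refine integral_mono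
          (((BddMeasurable.sum _ fun i _ => hf.comp (hW i)).abs_rpow hp0).integrable μ)
          (((BddMeasurable.const _).mul (BddMeasurable.sum _ fun i _ => hterm i)).integrable μ)
          fun ω => ?_
        have h1 := Real.rpow_sum_le_const_mul_sum_rpow (Finset.range n) (fun i => f (W i ω)) hp.le
        rw [Finset.card_range] at h1
        exact (Real.rpow_le_rpow (abs_nonneg _) (Finset.abs_sum_le_sum_abs _ _) hp0).trans h1
    _ = (n : ℝ) ^ (p - 1) * (n * ∫ ω, |f (Y ω)| ^ p ∂μ) := by
        rw [integral_const_mul, integral_finsetSum _ fun i _ => (hterm i).integrable μ]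
        rw [Finset.sum_congr rfl fun i _ =>
          integral_comp_eq hid (f := fun x => |f x| ^ p) (hf.abs_rpow hp0).1 i]
        simp
    _ ≤ (n : ℝ) ^ (1 : ℝ) * (n * ∫ ω, |f (Y ω)| ^ p ∂μ) := by
        gcongr
        · linarith
    _ = _ := by rw [Real.rpow_one]; ring

/-- The factor `9` comes from splitting into three parts, and `288 = 9 · (16 + 16)` from the two
triangular ones. -/
theorem integral_abs_sum_rpow_mul_abs_sum_rpow_le (hp : 1 < p) (hp2 : p ≤ 2)
    (hW : ∀ i, Measurable (W i)) (hind : iIndepFun W μ) (hid : ∀ i, IdentDistrib (W i) Y μ μ)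
    (hf : BddMeasurable f) (hg : BddMeasurable g) (hf0 : ∫ ω, f (Y ω) ∂μ = 0)
    (hg0 : ∫ ω, g (Y ω) ∂μ = 0) (n : ℕ) :
    ∫ ω, |∑ i ∈ Finset.range n, f (W i ω)| ^ p * |∑ i ∈ Finset.range n, g (W i ω)| ^ p ∂μ
      ≤ 288 * ((n : ℝ) ^ 2 * ((∫ ω, |f (Y ω)| ^ p ∂μ) * ∫ ω, |g (Y ω)| ^ p ∂μ)) +
        9 * ((n : ℝ) ^ 2 * ∫ ω, |f (Y ω)| ^ p * |g (Y ω)| ^ p ∂μ) := by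
  have hp0 : 0 ≤ p := by linarith
  have hSf : ∀ k, BddMeasurable fun ω => ∑ i ∈ Finset.range k, f (W i ω) :=
    fun k => BddMeasurable.sum _ fun i _ => hf.comp (hW i)
  have hSg : ∀ k, BddMeasurable fun ω => ∑ i ∈ Finset.range k, g (W i ω) :=
    fun k => BddMeasurable.sum _ fun i _ => hg.comp (hW i)
  have b1 : BddMeasurable fun ω =>
      |∑ j ∈ Finset.range n, g (W j ω) * ∑ i ∈ Finset.range j, f (W i ω)| ^ p :=
    (BddMeasurable.sum _ fun j _ => (hg.comp (hW j)).mul (hSf j)).abs_rpow hp0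
  have b2 : BddMeasurable fun ω =>
      |∑ j ∈ Finset.range n, f (W j ω) * ∑ i ∈ Finset.range j, g (W i ω)| ^ p :=
    (BddMeasurable.sum _ fun j _ => (hf.comp (hW j)).mul (hSg j)).abs_rpow hp0
  have b3 : BddMeasurable fun ω => |∑ j ∈ Finset.range n, f (W j ω) * g (W j ω)| ^ p :=
    (BddMeasurable.sum _ fun j _ => (hf.comp (hW j)).mul (hg.comp (hW j))).abs_rpow hp0
  have h1 := integral_abs_triangular_sum_rpow_le hp hp2 hW hind hid hf hg hf0 hg0 n
  have h2 := integral_abs_triangular_sum_rpow_le hp hp2 hW hind hid hg hf hg0 hf0 n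
  have h3 := integral_abs_sum_mul_rpow_le hp hp2 hW hid (hf.mul hg) n
  simp only [abs_mul (f (Y _)), Real.mul_rpow (abs_nonneg _) (abs_nonneg _)] at h3
  calc _ ≤ ∫ ω, 9 * (|∑ j ∈ Finset.range n, g (W j ω) * ∑ i ∈ Finset.range j, f (W i ω)| ^ p +
        |∑ j ∈ Finset.range n, f (W j ω) * ∑ i ∈ Finset.range j, g (W i ω)| ^ p +
        |∑ j ∈ Finset.range n, f (W j ω) * g (W j ω)| ^ p) ∂μ := by
        refine integral_mono ((((hSf n).abs_rpow hp0).mul ((hSg n).abs_rpow hp0)).integrable μ)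
          (((BddMeasurable.const 9).mul ((b1.add b2).add b3)).integrable μ) fun ω => ?_
        simp only
        rw [← Real.mul_rpow (abs_nonneg _) (abs_nonneg _), ← abs_mul, sum_mul_sum_eq_triangular]
        exact abs_add_add_rpow_le hp0 hp2 _ _ _
    _ ≤ _ := by
        rw [integral_const_mul, integral_add ((b1.add b2).integrable μ) (b3.integrable μ),
          integral_add (b1.integrable μ) (b2.integrable μ)]
        linarith

end Moments

/-! ### Billingsley's maximal inequality by chaining. -/

section MaximalInequality

/-- `θ` is chosen close enough to `1` that `2 θ^(-q) 2^(-β)` equals `ρ = 2^((1-β)/2) < 1`; then `K`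
solves `K ρ + 2 (1-θ)^(-q) = K`. The inequality closes the induction in the maximal inequality. -/
theorem exists_chaining_constants {q β : ℝ} (hq : 0 < q) (hβ : 1 < β) :
    ∃ θ K : ℝ, 0 < θ ∧ θ < 1 ∧ 0 ≤ K ∧
      2 * (K * θ ^ (-q) * 2⁻¹ ^ β) + 2 * (1 - θ) ^ (-q) ≤ K := by
  have hθ1 : (2 : ℝ) ^ ((1 - β) / (2 * q)) < 1 :=
    Real.rpow_lt_one_of_one_lt_of_neg one_lt_two
      (div_neg_of_neg_of_pos (by linarith) (by linarith))
  have hρ1 : (2 : ℝ) ^ ((1 - β) / 2) < 1 :=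
    Real.rpow_lt_one_of_one_lt_of_neg one_lt_two (by linarith)
  have hρ : 2 * (((2 : ℝ) ^ ((1 - β) / (2 * q))) ^ (-q) * 2⁻¹ ^ β) = 2 ^ ((1 - β) / 2) := by
    rw [← Real.rpow_mul zero_le_two, Real.inv_rpow zero_le_two, ← Real.rpow_neg zero_le_two]
    nth_rewrite 1 [← Real.rpow_one 2]
    rw [← Real.rpow_add zero_lt_two, ← Real.rpow_add zero_lt_two]
    congr 1
    field_simp
    ring
  generalize (2 : ℝ) ^ ((1 - β) / 2) = ρ at *
  have hθ0 : (0 : ℝ) < 2 ^ ((1 - β) / (2 * q)) := by positivity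
  generalize (2 : ℝ) ^ ((1 - β) / (2 * q)) = θ at *
  have h0 : 0 ≤ (1 - θ) ^ (-q) := Real.rpow_nonneg (by linarith) _
  refine ⟨θ, 2 * (1 - θ) ^ (-q) / (1 - ρ), hθ0, hθ1,
    div_nonneg (by linarith) (by linarith), ?_⟩
  have h1 : 2 * (1 - θ) ^ (-q) / (1 - ρ) * (1 - ρ) = 2 * (1 - θ) ^ (-q) :=
    div_mul_cancel₀ _ (by linarith)
  generalize 2 * (1 - θ) ^ (-q) / (1 - ρ) = K at *
  have h2 : 2 * (K * θ ^ (-q) * 2⁻¹ ^ β) = K * ρ := by rw [← hρ]; ring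
  linarith

variable {Ω : Type*} [MeasurableSpace Ω] {μ : Measure Ω} [IsFiniteMeasure μ]
  {T : Type*} [LinearOrder T]

/-- One chaining step: `h` splits the interval from `s` to `u`, and `v`, `w` are the end points of
one of the two parts. -/
theorem measureReal_setOf_exists_le_add {Z : Ω → T → ℝ} {A : Finset T} {s h u v w : T} {x y : ℝ}
    (hx : 0 ≤ x) (hy : 0 ≤ y) (hvw : (v = s ∧ w = h) ∨ (v = h ∧ w = u)) :
    μ.real {ω | ∃ t ∈ A, x + y ≤ |Z ω t - Z ω s| ∧ x + y ≤ |Z ω u - Z ω t|} ≤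
      μ.real {ω | ∃ t ∈ A.erase h, x ≤ |Z ω t - Z ω v| ∧ x ≤ |Z ω w - Z ω t|} +
      μ.real {ω | y ≤ |Z ω h - Z ω s| ∧ y ≤ |Z ω u - Z ω h|} := by
  refine (measureReal_mono ?_).trans (measureReal_union_le _ _)
  rintro ω ⟨t, htA, h1, h2⟩
  by_contra hcon
  rw [mem_union, not_or] at hcon
  obtain ⟨ht, hD⟩ := hcon
  -- Off the middle event, `Z h` is `y`-close to `Z s` or to `Z u`. A value `x`-close to `Z h` is
  -- then `(x + y)`-close to the same end.
  have hD' : |Z ω h - Z ω s| < y ∨ |Z ω u - Z ω h| < y := by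
    by_contra! H
    exact hD H
  have htri1 := abs_sub_le (Z ω t) (Z ω h) (Z ω s)
  have htri2 := abs_sub_le (Z ω u) (Z ω h) (Z ω t)
  rw [abs_sub_comm (Z ω t) (Z ω h)] at htri1
  by_cases hth : t = h
  · subst hth
    rcases hD' with H | H <;> linarith
  have ht' : |Z ω t - Z ω v| < x ∨ |Z ω w - Z ω t| < x := by
    by_contra! H
    exact ht ⟨t, Finset.mem_erase.2 ⟨hth, htA⟩, H⟩
  rcases hvw with ⟨rfl, rfl⟩ | ⟨rfl, rfl⟩
  · rcases ht' with H | H <;> rcases hD' with H' | H' <;> linarith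
  · rw [abs_sub_comm (Z ω t)] at ht'
    rcases ht' with H | H <;> rcases hD' with H' | H' <;> linarith

/-- Billingsley's maximal inequality for the fluctuations of a process between two times. -/
theorem measureReal_exists_le_of_product_bound {Z : Ω → T → ℝ} {G : T → ℝ} (hG : Monotone G)
    {C q β θ K : ℝ} (hC : 0 ≤ C) (hβ : 0 ≤ β) (hθ : 0 < θ) (hθ1 : θ < 1) (hK0 : 0 ≤ K)
    (hK : 2 * (K * θ ^ (-q) * 2⁻¹ ^ β) + 2 * (1 - θ) ^ (-q) ≤ K)
    (hZ : ∀ s t u, s < t → t < u → ∀ x : ℝ, 0 < x →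
      μ.real {ω | x ≤ |Z ω t - Z ω s| ∧ x ≤ |Z ω u - Z ω t|} ≤ C * x ^ (-q) * (G u - G s) ^ β)
    (A : Finset T) : ∀ s u, s ≤ u → (∀ t ∈ A, s < t ∧ t < u) → ∀ x : ℝ, 0 < x →
      μ.real {ω | ∃ t ∈ A, x ≤ |Z ω t - Z ω s| ∧ x ≤ |Z ω u - Z ω t|} ≤
        K * (C * x ^ (-q) * (G u - G s) ^ β) := by
  induction A using Finset.strongInduction with
  | H A ih =>
  intro s u hsu hA x hx
  have hd : 0 ≤ G u - G s := sub_nonneg.2 (hG hsu)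
  have hx1 : 0 < θ * x := by positivity
  have hx2 : 0 < (1 - θ) * x := mul_pos (by linarith) hx
  have hsum : θ * x + (1 - θ) * x = x := by ring
  -- `B` is the part of `A` in the lower or upper half of the `G`-mass, and `h` is its last or first
  -- point respectively. The other points of `B` lie strictly inside an interval with at most half
  -- the mass, so induction applies with threshold `θ x`; the rest `(1 - θ) x` is spent on the
  -- increments at `h`.
  have key : ∀ B ⊆ A, ∀ h ∈ B, ∀ v w : T, (v = s ∧ w = h) ∨ (v = h ∧ w = u) →
      (∀ t ∈ B.erase h, v < t ∧ t < w) → G w - G v ≤ 2⁻¹ * (G u - G s) →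
      μ.real {ω | ∃ t ∈ B, x ≤ |Z ω t - Z ω s| ∧ x ≤ |Z ω u - Z ω t|} ≤
        (K * θ ^ (-q) * 2⁻¹ ^ β + (1 - θ) ^ (-q)) * (C * x ^ (-q) * (G u - G s) ^ β) := by
    intro B hBA h hh v w hvw hB hGvw
    have hshu := hA h (hBA hh)
    have hvw' : v ≤ w := by
      rcases hvw with ⟨rfl, rfl⟩ | ⟨rfl, rfl⟩
      exacts [hshu.1.le, hshu.2.le]
    have h1 := measureReal_setOf_exists_le_add (μ := μ) (Z := Z) (A := B) hx1.le hx2.le hvw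
    rw [hsum] at h1
    have h2 := ih (B.erase h) ((Finset.erase_ssubset hh).trans_subset hBA) v w hvw' hB _ hx1
    have h3 := hZ s h u hshu.1 hshu.2 _ hx2
    have h4 : (G w - G v) ^ β ≤ 2⁻¹ ^ β * (G u - G s) ^ β := by
      rw [← Real.mul_rpow (by norm_num) hd]
      exact Real.rpow_le_rpow (sub_nonneg.2 (hG hvw')) hGvw hβ
    rw [Real.mul_rpow hθ.le hx.le] at h2
    rw [Real.mul_rpow (by linarith) hx.le] at h3
    have h5 : 0 ≤ K * (C * (θ ^ (-q) * x ^ (-q))) := by positivity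
    have h6 := mul_le_mul_of_nonneg_left h4 h5
    calc _ ≤ _ := h1
      _ ≤ K * (C * (θ ^ (-q) * x ^ (-q))) * (2⁻¹ ^ β * (G u - G s) ^ β) +
          C * ((1 - θ) ^ (-q) * x ^ (-q)) * (G u - G s) ^ β :=
        add_le_add (h2.trans (by rw [← mul_assoc]; exact h6)) h3
      _ = _ := by ring
  have hθ1q : 0 ≤ (1 - θ) ^ (-q) := Real.rpow_nonneg (by linarith) _
  have hnn : 0 ≤ (K * θ ^ (-q) * 2⁻¹ ^ β + (1 - θ) ^ (-q)) * (C * x ^ (-q) * (G u - G s) ^ β) := by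
    have : 0 ≤ (G u - G s) ^ β := Real.rpow_nonneg hd _
    positivity
  have hfinal : 2 * ((K * θ ^ (-q) * 2⁻¹ ^ β + (1 - θ) ^ (-q)) *
      (C * x ^ (-q) * (G u - G s) ^ β)) ≤ K * (C * x ^ (-q) * (G u - G s) ^ β) := by
    have : 0 ≤ (G u - G s) ^ β := Real.rpow_nonneg hd _
    rw [← mul_assoc]
    gcongr
    linarith
  have hleft : μ.real {ω | ∃ t ∈ A.filter (fun t => G t - G s ≤ 2⁻¹ * (G u - G s)),
      x ≤ |Z ω t - Z ω s| ∧ x ≤ |Z ω u - Z ω t|} ≤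
        (K * θ ^ (-q) * 2⁻¹ ^ β + (1 - θ) ^ (-q)) * (C * x ^ (-q) * (G u - G s) ^ β) := by
    rcases (A.filter (fun t => G t - G s ≤ 2⁻¹ * (G u - G s))).eq_empty_or_nonempty with he | hne
    · rw [he]; simpa using hnn
    · have hmem := Finset.max'_mem _ hne
      refine key _ (Finset.filter_subset _ _) _ hmem s _ (Or.inl ⟨rfl, rfl⟩) (fun t ht => ?_)
        (Finset.mem_filter.1 hmem).2
      have ht' := Finset.mem_of_mem_erase ht
      exact ⟨(hA t (Finset.mem_filter.1 ht').1).1,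
        (Finset.le_max' _ t ht').lt_of_ne (Finset.ne_of_mem_erase ht)⟩
  have hright : μ.real {ω | ∃ t ∈ A.filter (fun t => ¬ G t - G s ≤ 2⁻¹ * (G u - G s)),
      x ≤ |Z ω t - Z ω s| ∧ x ≤ |Z ω u - Z ω t|} ≤
        (K * θ ^ (-q) * 2⁻¹ ^ β + (1 - θ) ^ (-q)) * (C * x ^ (-q) * (G u - G s) ^ β) := by
    rcases (A.filter (fun t => ¬ G t - G s ≤ 2⁻¹ * (G u - G s))).eq_empty_or_nonempty
      with he | hne
    · rw [he]; simpa using hnn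
    · have hmem := Finset.min'_mem _ hne
      refine key _ (Finset.filter_subset _ _) _ hmem _ u (Or.inr ⟨rfl, rfl⟩) (fun t ht => ?_) ?_
      · have ht' := Finset.mem_of_mem_erase ht
        exact ⟨(Finset.min'_le _ t ht').lt_of_ne (Finset.ne_of_mem_erase ht).symm,
          (hA t (Finset.mem_filter.1 ht').1).2⟩
      · have := (Finset.mem_filter.1 hmem).2
        linarith
  calc _ ≤ _ := measureReal_mono ?_
    _ ≤ _ := measureReal_union_le _ _
    _ ≤ _ := add_le_add hleft hright
    _ ≤ _ := by linarith
  rintro ω ⟨t, htA, ht⟩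
  by_cases hGt : G t - G s ≤ 2⁻¹ * (G u - G s)
  · exact Or.inl ⟨t, Finset.mem_filter.2 ⟨htA, hGt⟩, ht⟩
  · exact Or.inr ⟨t, Finset.mem_filter.2 ⟨htA, hGt⟩, ht⟩

end MaximalInequality

/-! ### Regular variation: truncated second moments and the scale `a_n`. -/

section Karamata

/-- A truncated second moment bound under a doubling condition for the tail `T`. -/
theorem exists_le_mul_sq_mul_of_doubling {T V : ℝ → ℝ} {α : ℝ} (hα : α < 2) (hT : Antitone T)
    (hpos : ∀ x, 0 < T x) (hlim : Tendsto (fun x => T (2 * x) / T x) atTop (𝓝 (2 ^ (-α))))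
    (hV : ∀ u, 0 ≤ u → V u ≤ u ^ 2)
    (hV2 : ∀ u, 0 ≤ u → V (2 * u) ≤ V u + 4 * u ^ 2 * T u) :
    ∃ C x₀ : ℝ, 0 ≤ C ∧ ∀ u, x₀ ≤ u → V u ≤ C * (u ^ 2 * T u) := by
  -- As `α < 2`, `4 · 2^(-α) > 1`; so `u² T(u)` eventually grows by a factor `ρ > 1` at each
  -- doubling.
  obtain ⟨ρ, hρ1, hρ⟩ : ∃ ρ : ℝ, 1 < ρ ∧ ρ / 4 < 2 ^ (-α) := by
    have h1 : (2 : ℝ) ^ (-2 : ℝ) < 2 ^ (-α) :=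
      Real.rpow_lt_rpow_of_exponent_lt one_lt_two (by linarith)
    have h2 : (2 : ℝ) ^ (-2 : ℝ) = 1 / 4 := by
      rw [Real.rpow_neg zero_le_two]; norm_num
    obtain ⟨y, hy1, hy2⟩ := exists_between h1
    rw [h2] at hy1
    exact ⟨4 * y, by linarith, by linarith⟩
  obtain ⟨x₁, hx₁⟩ := eventually_atTop.1 (hlim.eventually_const_lt hρ)
  obtain ⟨x₀, hx₀1, hx₀⟩ : ∃ x₀ : ℝ, 1 ≤ x₀ ∧ x₁ ≤ x₀ :=
    ⟨max 1 x₁, le_max_left _ _, le_max_right _ _⟩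
  have hW : ∀ u, x₀ ≤ u → ρ * (u ^ 2 * T u) ≤ (2 * u) ^ 2 * T (2 * u) := fun u hu => by
    have h := hx₁ u (hx₀.trans hu)
    rw [lt_div_iff₀ (hpos u)] at h
    nlinarith [sq_nonneg u]
  -- The first entry gives `C + 4 ≤ C ρ`, which carries the bound from `u` to `2u`; the second
  -- covers the initial range `x₀ ≤ u ≤ 2 x₀`, where `V u ≤ u²` is enough.
  set C := max (4 / (ρ - 1)) (4 / T (2 * x₀)) with hCdef
  have hC1 : 4 ≤ C * (ρ - 1) := by
    rw [← div_le_iff₀ (by linarith)]; exact le_max_left _ _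
  have hC2 : 4 ≤ C * T (2 * x₀) := by
    rw [← div_le_iff₀ (hpos _)]; exact le_max_right _ _
  have hC0 : 0 ≤ C := le_max_of_le_left (div_nonneg (by norm_num) (by linarith))
  refine ⟨C, x₀, hC0, fun u hu => ?_⟩
  have hind : ∀ k : ℕ, ∀ u, x₀ ≤ u → u ≤ 2 ^ (k + 1) * x₀ → V u ≤ C * (u ^ 2 * T u) := by
    intro k
    induction k with
    | zero =>
      intro u hu hu2
      have h1 := hV u (by linarith)
      have h2 : T (2 * x₀) ≤ T u := hT (by simpa using hu2)
      have h3 := mul_le_mul_of_nonneg_left h2 hC0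
      nlinarith [sq_nonneg u]
    | succ k ih =>
      intro u hu hu2
      rcases le_total u (2 * x₀) with h | h
      · refine ih u hu (h.trans ?_)
        have : (1 : ℝ) ≤ 2 ^ k := one_le_pow₀ (by norm_num)
        rw [pow_succ]
        nlinarith
      · have h1 : x₀ ≤ u / 2 := by linarith
        have h2 := ih (u / 2) h1 (by rw [pow_succ] at hu2; linarith)
        have h3 := hV2 (u / 2) (by linarith)
        have h4 := hW (u / 2) h1
        rw [mul_div_cancel₀ u (two_ne_zero)] at h3 h4
        have h5 : 0 ≤ (u / 2) ^ 2 * T (u / 2) := mul_nonneg (sq_nonneg _) (hpos _).le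
        rw [mul_assoc] at h3
        generalize (u / 2) ^ 2 * T (u / 2) = w at *
        have h6 : V u ≤ (C + 4) * w := by linarith
        have h7 := mul_le_mul_of_nonneg_left h4 hC0
        nlinarith
  obtain ⟨k, hk⟩ := pow_unbounded_of_one_lt u (one_lt_two (α := ℝ))
  refine hind k u hu (hk.le.trans ?_)
  have : (0 : ℝ) < 2 ^ k := by positivity
  rw [pow_succ]
  nlinarith

variable {Ω : Type*} [MeasurableSpace Ω] {μ : Measure Ω} [IsFiniteMeasure μ] {Y : Ω → ℝ} {α : ℝ}

/-- A tail vanishing at `x` vanishes beyond, and the ratio with `c = 1` would eventually be `0 / 0 =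
0` rather than tend to `1`. -/
theorem HasRegularlyVaryingTail.measureReal_pos (h : HasRegularlyVaryingTail μ Y α) (x : ℝ) :
    0 < μ.real {ω | x < Y ω} := by
  by_contra hx
  have hx0 : μ.real {ω | x < Y ω} = 0 := le_antisymm (not_lt.1 hx) measureReal_nonneg
  have hev : (fun y : ℝ => μ.real {ω | 1 * y < Y ω} / μ.real {ω | y < Y ω}) =ᶠ[atTop] fun _ => 0 := by
    filter_upwards [eventually_ge_atTop x] with y hy
    have : μ.real {ω | y < Y ω} = 0 := le_antisymm
      ((measureReal_mono fun ω (hω : y < Y ω) => hy.trans_lt hω).trans hx0.le) measureReal_nonneg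
    rw [this, div_zero]
  have := tendsto_nhds_unique ((h 1 one_pos).congr' hev) tendsto_const_nhds
  simp at this

-- Passing from level `u` to `2u` adds only values in `(u, 2u]`, whose squares are at most `4u²`;
-- this is the recursion needed for the doubling argument.
open Classical in
theorem HasRegularlyVaryingTail.exists_truncated_second_moment_le
    (h : HasRegularlyVaryingTail μ Y α) [IsProbabilityMeasure μ] (hα : α < 2) (hY : Measurable Y)
    (hY0 : ∀ ω, 0 ≤ Y ω) :
    ∃ C x₀ : ℝ, 0 ≤ C ∧ ∀ u, x₀ ≤ u →
      ∫ ω, (if Y ω ≤ u then Y ω else 0) ^ 2 ∂μ ≤ C * (u ^ 2 * μ.real {ω | u < Y ω}) := by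
  have hb : ∀ u : ℝ, BddMeasurable fun ω => if Y ω ≤ u then Y ω else 0 := fun u => by
    refine ⟨Measurable.ite (measurableSet_le hY measurable_const) hY measurable_const, |u|,
      fun ω => ?_⟩
    dsimp only
    split_ifs with hu
    · rw [abs_of_nonneg (hY0 ω)]; exact hu.trans (le_abs_self u)
    · simp
  have hb2 : ∀ u : ℝ, BddMeasurable fun ω => (if Y ω ≤ u then Y ω else 0) ^ 2 := fun u => by
    simpa only [sq] using (hb u).mul (hb u)
  refine exists_le_mul_sq_mul_of_doubling (T := fun x => μ.real {ω | x < Y ω})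
    (V := fun u => ∫ ω, (if Y ω ≤ u then Y ω else 0) ^ 2 ∂μ) hα
    (fun x y hxy => measureReal_mono fun ω (hω : y < Y ω) => hxy.trans_lt hω)
    h.measureReal_pos (h 2 two_pos) (fun u hu => ?_) (fun u hu => ?_)
  · calc ∫ ω, (if Y ω ≤ u then Y ω else 0) ^ 2 ∂μ ≤ ∫ _, u ^ 2 ∂μ := by
          refine integral_mono ((hb2 u).integrable μ) (integrable_const _) fun ω => ?_
          simp only
          split_ifs with hYu
          · exact pow_le_pow_left₀ (hY0 ω) hYu 2
          · simpa using sq_nonneg u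
      _ = u ^ 2 := by simp
  · have hm : MeasurableSet {ω | u < Y ω} := measurableSet_lt measurable_const hY
    have hi : Integrable ({ω | u < Y ω}.indicator fun _ => 4 * u ^ 2) μ :=
      (integrable_const _).indicator hm
    calc ∫ ω, (if Y ω ≤ 2 * u then Y ω else 0) ^ 2 ∂μ
        ≤ ∫ ω, ((if Y ω ≤ u then Y ω else 0) ^ 2 +
            {ω | u < Y ω}.indicator (fun _ => 4 * u ^ 2) ω) ∂μ := by
          refine integral_mono ((hb2 _).integrable μ) (((hb2 u).integrable μ).add hi) fun ω => ?_
          simp only [indicator_apply, mem_ofPred_eq]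
          have := hY0 ω
          split_ifs <;> nlinarith
      _ = _ := by
          rw [integral_add ((hb2 u).integrable μ) hi, integral_indicator hm]
          simp
          ring

/-- The tail at `a n` tends to `0`, while the tail at any fixed level is positive. -/
theorem HasRegularlyVaryingTail.tendsto_scale_atTop (h : HasRegularlyVaryingTail μ Y α) {a : ℕ → ℝ}
    (ha : Tendsto (fun n : ℕ => (n : ℝ) * μ.real {ω | a n < Y ω}) atTop (𝓝 1)) :
    Tendsto a atTop atTop := by
  have h0 : Tendsto (fun n => μ.real {ω | a n < Y ω}) atTop (𝓝 0) := by
    have h1 := ha.mul tendsto_inv_atTop_nhds_zero_nat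
    rw [mul_zero] at h1
    refine h1.congr' ?_
    filter_upwards [eventually_gt_atTop 0] with n hn
    field_simp
  refine tendsto_atTop.2 fun M => ?_
  filter_upwards [h0.eventually_lt_const (h.measureReal_pos M)] with n hn
  by_contra! hM
  exact hn.not_ge (measureReal_mono fun ω (hω : M < Y ω) => hM.trans hω)

theorem HasRegularlyVaryingTail.tendsto_mul_measureReal (h : HasRegularlyVaryingTail μ Y α)
    {a : ℕ → ℝ} (ha : Tendsto (fun n : ℕ => (n : ℝ) * μ.real {ω | a n < Y ω}) atTop (𝓝 1))
    {c : ℝ} (hc : 0 < c) :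
    Tendsto (fun n : ℕ => (n : ℝ) * μ.real {ω | a n * c < Y ω}) atTop (𝓝 (c ^ (-α))) := by
  have h1 := ha.mul ((h c hc).comp (h.tendsto_scale_atTop ha))
  rw [one_mul] at h1
  refine h1.congr fun n => ?_
  have := (h.measureReal_pos (a n)).ne'
  simp only [Function.comp, mul_comm (a n) c]
  field_simp

end Karamata

/-! ### From the supremum to a finite grid and to finite sets of times. -/

section RightContinuous

variable {Ω : Type*} {l r : ℝ}

theorem lt_supNorm_subset {Z : Ω → Icc l r → ℝ} {τ : ℕ → Icc l r} {N : ℕ} {η : ℝ} (hη : 0 < η)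
    (hτ : ∀ t, ∃ i < N, τ i ≤ t ∧ t ≤ τ (i + 1)) :
    {ω | η < supNorm (Z ω)} ⊆ (⋃ i ∈ Finset.range (N + 1), {ω | η / 2 ≤ |Z ω (τ i)|}) ∪
      ⋃ i ∈ Finset.range N, {ω | ∃ t, τ i ≤ t ∧ t ≤ τ (i + 1) ∧
        η / 2 < |Z ω t - Z ω (τ i)| ∧ η / 2 < |Z ω (τ (i + 1)) - Z ω t|} := by
  intro ω hω
  by_contra hcon
  rw [mem_union, not_or] at hcon
  obtain ⟨h1, h2⟩ := hcon
  have h1' : ∀ i < N + 1, |Z ω (τ i)| < η / 2 := fun i hi => by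
    by_contra! h
    exact h1 (mem_biUnion (Finset.mem_coe.2 (Finset.mem_range.2 hi)) h)
  refine not_le.2 hω (Real.iSup_le (fun t => ?_) hη.le)
  obtain ⟨i, hi, hit, hti⟩ := hτ t
  have h2' : |Z ω t - Z ω (τ i)| ≤ η / 2 ∨ |Z ω (τ (i + 1)) - Z ω t| ≤ η / 2 := by
    by_contra! h
    exact h2 (mem_biUnion (Finset.mem_coe.2 (Finset.mem_range.2 hi)) ⟨t, hit, hti, h⟩)
  have h3 := h1' i (by omega)
  have h4 := h1' (i + 1) (by omega)
  have h5 := abs_sub_abs_le_abs_sub (Z ω t) (Z ω (τ i))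
  have h6 := abs_sub_abs_le_abs_sub (Z ω t) (Z ω (τ (i + 1)))
  rw [abs_sub_comm (Z ω t) (Z ω (τ (i + 1)))] at h6
  rcases h2' with h | h <;> linarith

/-- Once uniform continuity makes every increment at most `κ`, `(ΔF)^β ≤ κ^(β-1) ΔF`, and the
right-hand sides telescope. -/
theorem exists_grid (hlr : l ≤ r) {F : Icc l r → ℝ} (hFc : Continuous F) (hF : Monotone F) {β : ℝ}
    (hβ : 1 < β) {δ : ℝ} (hδ : 0 < δ) :
    ∃ (N : ℕ) (τ : ℕ → Icc l r), Monotone τ ∧ (∀ t, ∃ i < N, τ i ≤ t ∧ t ≤ τ (i + 1)) ∧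
      ∑ i ∈ Finset.range N, (F (τ (i + 1)) - F (τ i)) ^ β < δ := by
  set M := F ⟨r, hlr, le_rfl⟩ - F ⟨l, le_rfl, hlr⟩ with hM
  have hM0 : 0 ≤ M := sub_nonneg.2 (hF (by exact hlr))
  obtain ⟨κ, hκ, hκδ⟩ : ∃ κ : ℝ, 0 < κ ∧ κ ^ (β - 1) * M < δ := by
    have h1 : Tendsto (fun κ : ℝ => κ ^ (β - 1) * M) (𝓝[>] 0) (𝓝 (0 * M)) := by
      refine Tendsto.mul_const _ ?_
      have := (Real.continuousAt_rpow_const 0 (β - 1) (Or.inr (by linarith))).tendsto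
      rw [Real.zero_rpow (by linarith)] at this
      exact this.mono_left nhdsWithin_le_nhds
    rw [zero_mul] at h1
    obtain ⟨κ, h2, h3⟩ := ((h1.eventually_lt_const hδ).and self_mem_nhdsWithin).exists
    exact ⟨κ, h3, h2⟩
  obtain ⟨d, hd, hFd⟩ := Metric.uniformContinuous_iff.1
    (CompactSpace.uniformContinuous_of_continuous hFc) κ hκ
  obtain ⟨n, hn⟩ := exists_nat_gt ((r - l) / d)
  -- At least one cell, even when `l = r`.
  set N := n + 1 with hN
  have hN0 : (0 : ℝ) < N := by positivity
  have hstep : (r - l) / N < d := by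
    rw [div_lt_iff₀ hN0]
    rw [div_lt_iff₀ hd] at hn
    rw [hN]; push_cast; linarith
  have hstep0 : 0 ≤ (r - l) / N := div_nonneg (by linarith) hN0.le
  let τ : ℕ → Icc l r := fun i => projIcc l r hlr (l + i * ((r - l) / N))
  have hτm : Monotone τ := fun i j hij => monotone_projIcc hlr (by gcongr)
  have hτ0 : τ 0 = ⟨l, le_rfl, hlr⟩ := by
    simp only [τ, Nat.cast_zero, zero_mul, add_zero, projIcc_left]
  have hτN : τ N = ⟨r, hlr, le_rfl⟩ := by
    have : l + N * ((r - l) / N) = r := by field_simp; ring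
    simp only [τ, this, projIcc_right]
  refine ⟨N, τ, hτm, fun t => ?_, ?_⟩
  · have hex : ∀ k, t ≤ τ k → 0 < k → ∃ i < k, τ i ≤ t ∧ t ≤ τ (i + 1) := by
      intro k
      induction k with
      | zero => intro _ h; omega
      | succ k ih =>
        intro h _
        rcases le_total (τ k) t with h' | h'
        · exact ⟨k, k.lt_succ_self, h', h⟩
        · rcases Nat.eq_zero_or_pos k with rfl | hk
          · exact ⟨0, Nat.one_pos, hτ0 ▸ t.2.1, h⟩
          · obtain ⟨i, hi, h2⟩ := ih h' hk
            exact ⟨i, by omega, h2⟩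
    exact hex N (by rw [hτN]; exact t.2.2) (by omega)
  · have hinc : ∀ i, F (τ (i + 1)) - F (τ i) ≤ κ := fun i => by
      have h1 : dist (τ (i + 1)) (τ i) < d := by
        have h2 := abs_projIcc_sub_projIcc (c := l + ((i + 1 : ℕ) : ℝ) * ((r - l) / N))
          (d := l + i * ((r - l) / N)) hlr
        rw [Subtype.dist_eq, Real.dist_eq]
        refine h2.trans_lt ?_
        push_cast
        rw [show l + ((i : ℝ) + 1) * ((r - l) / N) - (l + i * ((r - l) / N)) = (r - l) / N by ring,
          abs_of_nonneg hstep0]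
        exact hstep
      have := hFd h1
      rw [Real.dist_eq] at this
      exact (le_abs_self _).trans this.le
    have hnn : ∀ i, 0 ≤ F (τ (i + 1)) - F (τ i) := fun i =>
      sub_nonneg.2 (hF (hτm i.le_succ))
    refine lt_of_le_of_lt ?_ hκδ
    calc ∑ i ∈ Finset.range N, (F (τ (i + 1)) - F (τ i)) ^ β
        ≤ ∑ i ∈ Finset.range N, κ ^ (β - 1) * (F (τ (i + 1)) - F (τ i)) := by
          refine Finset.sum_le_sum fun i _ => ?_
          rcases (hnn i).eq_or_lt with h | h
          · rw [← h, Real.zero_rpow (by linarith), mul_zero]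
          · calc (F (τ (i + 1)) - F (τ i)) ^ β
                = (F (τ (i + 1)) - F (τ i)) ^ (β - 1) * (F (τ (i + 1)) - F (τ i)) := by
                  rw [← Real.rpow_add_one h.ne', sub_add_cancel]
              _ ≤ _ := by
                  have := Real.rpow_le_rpow h.le (hinc i) (by linarith : 0 ≤ β - 1)
                  gcongr
      _ = κ ^ (β - 1) * M := by
          rw [← Finset.mul_sum, Finset.sum_range_sub (fun i => F (τ i)), hτ0, hτN]

variable [MeasurableSpace Ω] {μ : Measure Ω} [IsFiniteMeasure μ]

/-- By right continuity the strict inequalities at `t` persist at a nearby later time of a countable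
dense set. The event is thus covered by a countable directed union over finite sets of times. -/
theorem measure_exists_lt_le_of_finset {Z : Ω → Icc l r → ℝ}
    (hZ : ∀ ω t, ContinuousWithinAt (Z ω) (Ici t) t) {s u : Icc l r} {x B : ℝ} (hx : 0 < x)
    (hB : ∀ A : Finset (Icc l r), (∀ t ∈ A, s < t ∧ t < u) →
      μ.real {ω | ∃ t ∈ A, x ≤ |Z ω t - Z ω s| ∧ x ≤ |Z ω u - Z ω t|} ≤ B) :
    μ {ω | ∃ t, s ≤ t ∧ t ≤ u ∧ x < |Z ω t - Z ω s| ∧ x < |Z ω u - Z ω t|} ≤ ENNReal.ofReal B := by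
  classical
  obtain ⟨D, hDc, hDd⟩ := TopologicalSpace.exists_countable_dense (Icc l r)
  have : Countable ↥(D ∩ Ioo s u) := (hDc.mono inter_subset_left).to_subtype
  let E : Finset ↥(D ∩ Ioo s u) → Set Ω := fun A =>
    {ω | ∃ t ∈ A, x ≤ |Z ω t - Z ω s| ∧ x ≤ |Z ω u - Z ω t|}
  have hE : Directed (· ⊆ ·) E := Monotone.directed_le fun A A' hAA' ω ⟨t, ht, h⟩ =>
    ⟨t, Finset.mem_of_subset hAA' ht, h⟩
  calc _ ≤ μ (⋃ A, E A) := measure_mono ?_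
    _ = ⨆ A, μ (E A) := hE.measure_iUnion
    _ ≤ _ := iSup_le fun A => ?_
  · rintro ω ⟨t, hst, htu, h1, h2⟩
    have htu' : t < u := htu.lt_of_ne (by rintro rfl; simp at h2; linarith)
    have hcont : Tendsto (Z ω) (𝓝[>] t) (𝓝 (Z ω t)) :=
      (hZ ω t).tendsto.mono_left (nhdsWithin_mono _ Ioi_subset_Ici_self)
    have e1 := (hcont.sub_const (Z ω s)).abs.eventually_const_lt h1
    have e2 := (hcont.const_sub (Z ω u)).abs.eventually_const_lt h2
    obtain ⟨v, hv, hv'⟩ := (mem_nhdsGT_iff_exists_Ioo_subset' htu').1 (e1.and e2)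
    obtain ⟨t', ht'D, ht'⟩ := hDd.inter_open_nonempty (Ioo t (min v u)) isOpen_Ioo
      (nonempty_Ioo.2 (lt_min hv htu')) |>.imp fun _ h => h.symm
    have h3 := hv' ⟨ht'.1, ht'.2.trans_le (min_le_left _ _)⟩
    exact mem_iUnion.2 ⟨{⟨t', ht'D, hst.trans_lt ht'.1, ht'.2.trans_le (min_le_right _ _)⟩},
      _, Finset.mem_singleton_self _, h3.1.le, h3.2.le⟩
  · have h := hB (A.image Subtype.val) (by
      intro t ht
      obtain ⟨t, _, rfl⟩ := Finset.mem_image.1 ht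
      exact t.2.2)
    rw [← ofReal_measureReal]
    refine ENNReal.ofReal_le_ofReal ((measureReal_mono ?_).trans h)
    rintro ω ⟨t, ht, h⟩
    exact ⟨t, Finset.mem_image_of_mem _ ht, h⟩

end RightContinuous

/-! ### The moment and maximal estimates applied to the truncated sums. -/

section TruncatedSum

open CadlagSpace

variable {Ω : Type*} [MeasurableSpace Ω] {μ : Measure Ω} {l r : ℝ}

theorem bddMeasurable_trunc (u : ℝ) (t : Icc l r) : BddMeasurable (trunc (l := l) (r := r) u t) :=
  ⟨measurable_trunc u t, |u|, abs_trunc_le u t⟩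

/-- The centered truncation as a function on path space; the centering is with respect to the law
of `Y`. -/
def centeredTrunc (μ : Measure Ω) (Y : Ω → CadlagSpace l r) (u : ℝ) (t : Icc l r)
    (x : CadlagSpace l r) : ℝ :=
  trunc u t x - ∫ ω, trunc u t (Y ω) ∂μ

theorem bddMeasurable_centeredTrunc (Y : Ω → CadlagSpace l r) (u : ℝ) (t : Icc l r) :
    BddMeasurable (centeredTrunc μ Y u t) :=
  (bddMeasurable_trunc u t).sub (BddMeasurable.const _)

variable {X : ℕ → Ω → CadlagSpace l r} {a : ℕ → ℝ}

/-- All summands become one fixed function of the i.i.d. paths, with indices `1, …, n` shifted to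
`range n`. -/
theorem truncatedSum_eq (hX_ident : ∀ i, IdentDistrib (X i) (X 0) μ μ) (ε : ℝ) (n : ℕ) (ω : Ω)
    (t : Icc l r) :
    truncatedSum μ X a ε n ω t =
      (a n)⁻¹ * ∑ i ∈ Finset.range n, centeredTrunc μ (X 0) (a n * ε) t (X (i + 1) ω) := by
  have h : ∀ i, ∫ ω', truncated (X i) (a n * ε) ω' t ∂μ = ∫ ω', trunc (a n * ε) t (X 0 ω') ∂μ :=
    fun i => integral_comp_eq hX_ident (measurable_trunc (a n * ε) t) i
  rw [truncatedSum, Finset.range_eq_Ico,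
    Finset.sum_Ico_add' (fun i => centeredTrunc μ (X 0) (a n * ε) t (X i ω)) 0 n 1]
  simp only [h]
  rfl

theorem truncatedSum_sub (hX_ident : ∀ i, IdentDistrib (X i) (X 0) μ μ) (ε : ℝ) (n : ℕ) (ω : Ω)
    (s t : Icc l r) :
    truncatedSum μ X a ε n ω t - truncatedSum μ X a ε n ω s =
      (a n)⁻¹ * ∑ i ∈ Finset.range n, (centeredTrunc μ (X 0) (a n * ε) t (X (i + 1) ω) -
        centeredTrunc μ (X 0) (a n * ε) s (X (i + 1) ω)) := by
  rw [truncatedSum_eq hX_ident, truncatedSum_eq hX_ident, ← mul_sub, Finset.sum_sub_distrib]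

variable {Y : Ω → CadlagSpace l r} [IsProbabilityMeasure μ]

theorem integral_centeredTrunc (hY : Measurable Y) (u : ℝ) (t : Icc l r) :
    ∫ ω, centeredTrunc μ Y u t (Y ω) ∂μ = 0 := by
  unfold centeredTrunc
  rw [integral_sub (((bddMeasurable_trunc u t).comp hY).integrable μ) (integrable_const _)]
  simp

theorem centeredIncrement_eq (hY : Measurable Y) (u : ℝ) (s t : Icc l r) (ω : Ω) :
    centeredIncrement μ Y u s t ω = centeredTrunc μ Y u t (Y ω) - centeredTrunc μ Y u s (Y ω) := by
  have h := integral_sub (((bddMeasurable_trunc u t).comp hY).integrable μ)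
    (((bddMeasurable_trunc u s).comp hY).integrable μ)
  change (trunc u t (Y ω) - trunc u s (Y ω)) - ∫ ω', (trunc u t (Y ω') - trunc u s (Y ω')) ∂μ = _
  rw [h, centeredTrunc, centeredTrunc]
  ring

/-- The centering is right continuous too, by dominated convergence with the constant bound `|u|`.
-/
theorem continuousWithinAt_centeredTrunc (hY : Measurable Y) (u : ℝ) (x : CadlagSpace l r)
    (t : Icc l r) : ContinuousWithinAt (fun s => centeredTrunc μ Y u s x) (Ici t) t := by
  refine (continuousWithinAt_trunc u x t).sub ?_
  exact continuousWithinAt_of_dominated (bound := fun _ => |u|)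
    (Eventually.of_forall fun s => ((measurable_trunc u s).comp hY).aestronglyMeasurable)
    (Eventually.of_forall fun s => Eventually.of_forall fun ω => abs_trunc_le u s (Y ω))
    (integrable_const _) (Eventually.of_forall fun ω => continuousWithinAt_trunc u (Y ω) t)

open Classical in
theorem integral_centeredTrunc_sq_le (hY : Measurable Y) (u : ℝ) (t : Icc l r) :
    ∫ ω, |centeredTrunc μ Y u t (Y ω)| ^ (2 : ℝ) ∂μ ≤
      ∫ ω, (if supNorm (Y ω) ≤ u then supNorm (Y ω) else 0) ^ 2 ∂μ := by
  have hb := (bddMeasurable_trunc u t).comp hY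
  have h1 : ∫ ω, |centeredTrunc μ Y u t (Y ω)| ^ (2 : ℝ) ∂μ =
      variance (fun ω => trunc u t (Y ω)) μ := by
    rw [variance_eq_integral hb.1.aemeasurable]
    simp only [Real.rpow_two, sq_abs, centeredTrunc]
  rw [h1]
  refine (variance_le_expectation_sq hb.1.aestronglyMeasurable).trans ?_
  have hs : Measurable fun ω => supNorm (Y ω) := measurable_supNorm.comp hY
  have hc : BddMeasurable fun ω => if supNorm (Y ω) ≤ u then supNorm (Y ω) else 0 := by
    refine ⟨Measurable.ite (measurableSet_le hs measurable_const) hs measurable_const, |u|,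
      fun ω => ?_⟩
    dsimp only
    split_ifs with hu
    · rw [abs_of_nonneg (supNorm_nonneg _)]; exact hu.trans (le_abs_self u)
    · simp
  refine integral_mono ?_ ?_ fun ω => ?_
  · simpa only [sq, Pi.mul_apply] using! (hb.mul hb).integrable μ
  · simpa only [sq] using (hc.mul hc).integrable μ
  · have h2 := abs_trunc_le_indicator u t (Y ω)
    calc (trunc u t (Y ω)) ^ 2 = |trunc u t (Y ω)| ^ 2 := (sq_abs _).symm
      _ ≤ _ := pow_le_pow_left₀ (abs_nonneg _) h2 2

theorem continuousWithinAt_truncatedSum (hX_meas : ∀ i, Measurable (X i))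
    (hX_ident : ∀ i, IdentDistrib (X i) (X 0) μ μ) (ε : ℝ) (n : ℕ) (ω : Ω) (t : Icc l r) :
    ContinuousWithinAt (truncatedSum μ X a ε n ω) (Ici t) t := by
  rw [show truncatedSum μ X a ε n ω = _ from funext fun s => truncatedSum_eq hX_ident ε n ω s]
  exact tendsto_const_nhds.mul (tendsto_finsetSum _ fun i _ =>
    continuousWithinAt_centeredTrunc (hX_meas 0) _ _ _)

-- Chebyshev's inequality, with the case `p = 2` of `integral_abs_sum_rpow_le`.
open Classical in
theorem measureReal_le_abs_truncatedSum_le (hX_meas : ∀ i, Measurable (X i))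
    (hX_indep : iIndepFun X μ) (hX_ident : ∀ i, IdentDistrib (X i) (X 0) μ μ)
    (ε : ℝ) (n : ℕ) (t : Icc l r) {x : ℝ} (hx : 0 < x) :
    μ.real {ω | x ≤ |truncatedSum μ X a ε n ω t|} ≤
      4 * (x ^ 2)⁻¹ * (n * ((a n)⁻¹ ^ 2 *
        ∫ ω, (if supNorm (X 0 ω) ≤ a n * ε then supNorm (X 0 ω) else 0) ^ 2 ∂μ)) := by
  have hb := bddMeasurable_centeredTrunc (μ := μ) (X 0) (a n * ε) t
  have hsum : BddMeasurable fun ω => ∑ i ∈ Finset.range n,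
      centeredTrunc μ (X 0) (a n * ε) t (X (i + 1) ω) :=
    BddMeasurable.sum _ fun i _ => hb.comp (hX_meas (i + 1))
  have h1 := integral_abs_sum_rpow_le (W := fun i => X (i + 1)) one_lt_two le_rfl
    (fun i => hX_meas (i + 1)) (hX_indep.precomp (add_left_injective 1))
    (fun i => hX_ident (i + 1)) hb (integral_centeredTrunc (hX_meas 0) _ t) n
  have h2 := integral_centeredTrunc_sq_le (μ := μ) (hX_meas 0) (a n * ε) t
  have h3 := mul_meas_ge_le_integral_of_nonneg (μ := μ)
    (f := fun ω => |truncatedSum μ X a ε n ω t| ^ (2 : ℝ))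
    (Eventually.of_forall fun ω => by simp only [Pi.zero_apply]; positivity)
    (by simp only [truncatedSum_eq hX_ident]
        exact (((BddMeasurable.const _).mul hsum).abs_rpow zero_le_two).integrable μ) (x ^ 2)
  have h4 : ∫ ω, |truncatedSum μ X a ε n ω t| ^ (2 : ℝ) ∂μ = (a n)⁻¹ ^ 2 *
      ∫ ω, |∑ i ∈ Finset.range n, centeredTrunc μ (X 0) (a n * ε) t (X (i + 1) ω)| ^ (2 : ℝ) ∂μ := by
    rw [← integral_const_mul]
    simp only [truncatedSum_eq hX_ident, Real.rpow_two, sq_abs, mul_pow]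
  have h5 : μ.real {ω | x ≤ |truncatedSum μ X a ε n ω t|} ≤
      μ.real {ω | x ^ 2 ≤ |truncatedSum μ X a ε n ω t| ^ (2 : ℝ)} := by
    refine measureReal_mono fun ω hω => ?_
    simp only [mem_ofPred_eq, Real.rpow_two] at hω ⊢
    exact pow_le_pow_left₀ hx.le hω 2
  have hx2 : 0 < x ^ 2 := by positivity
  rw [h4] at h3
  refine h5.trans ?_
  rw [mul_assoc, mul_left_comm, le_inv_mul_iff₀ hx2]
  refine h3.trans ?_
  calc _ ≤ (a n)⁻¹ ^ 2 * (4 * (n *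
        ∫ ω, (if supNorm (X 0 ω) ≤ a n * ε then supNorm (X 0 ω) else 0) ^ 2 ∂μ)) :=
        mul_le_mul_of_nonneg_left (h1.trans (by gcongr)) (sq_nonneg _)
    _ = _ := by ring

/-- Markov's inequality at level `x^(2p)` for the product of the two increments. The off-diagonal
part uses `h_single` on both intervals, the diagonal part `h_product`; `297 = 288 + 9`. -/
theorem measureReal_truncatedSum_product_le {p γ : ℝ} (hp : 1 < p) (hp2 : p ≤ 2) (hγ : 0 ≤ γ)
    (hX_meas : ∀ i, Measurable (X i)) (hX_indep : iIndepFun X μ)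
    (hX_ident : ∀ i, IdentDistrib (X i) (X 0) μ μ) {n : ℕ} (han : 0 < a n) {ε : ℝ}
    {G : Icc l r → ℝ} (hG : Monotone G)
    (h_single : ∀ s t : Icc l r, s < t →
      (n : ℝ) * (a n) ^ (-p) * ∫ ω, |centeredIncrement μ (X 0) (a n * ε) s t ω| ^ p ∂μ
        ≤ (G t - G s) ^ γ)
    (h_product : ∀ s t u : Icc l r, s < t → t < u →
      (n : ℝ) ^ 2 * (a n) ^ (-2 * p) *
          ∫ ω, |centeredIncrement μ (X 0) (a n * ε) s t ω| ^ p *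
            |centeredIncrement μ (X 0) (a n * ε) t u ω| ^ p ∂μ
        ≤ (G u - G s) ^ (2 * γ))
    (s t u : Icc l r) (hst : s < t) (htu : t < u) (x : ℝ) (hx : 0 < x) :
    μ.real {ω | x ≤ |truncatedSum μ X a ε n ω t - truncatedSum μ X a ε n ω s| ∧
        x ≤ |truncatedSum μ X a ε n ω u - truncatedSum μ X a ε n ω t|} ≤
      297 * x ^ (-(2 * p)) * (G u - G s) ^ (2 * γ) := by
  have hp0 : 0 ≤ p := by linarith
  set D : Icc l r → Icc l r → CadlagSpace l r → ℝ := fun s t x =>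
    centeredTrunc μ (X 0) (a n * ε) t x - centeredTrunc μ (X 0) (a n * ε) s x with hD
  have hDb : ∀ s t, BddMeasurable (D s t) := fun s t =>
    (bddMeasurable_centeredTrunc _ _ t).sub (bddMeasurable_centeredTrunc _ _ s)
  have hD0 : ∀ s t, ∫ ω, D s t (X 0 ω) ∂μ = 0 := fun s t => by
    have hi := fun t => (((bddMeasurable_centeredTrunc (μ := μ) (X 0) (a n * ε) t).comp
      (hX_meas 0)).integrable μ)
    simp only [hD]
    rw [integral_sub (hi t) (hi s), integral_centeredTrunc (hX_meas 0),
      integral_centeredTrunc (hX_meas 0), sub_zero]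
  have hDsum : ∀ s t, BddMeasurable fun ω => ∑ i ∈ Finset.range n, D s t (X (i + 1) ω) :=
    fun s t => BddMeasurable.sum _ fun i _ => (hDb s t).comp (hX_meas (i + 1))
  have hU : ∀ s t ω, truncatedSum μ X a ε n ω t - truncatedSum μ X a ε n ω s =
      (a n)⁻¹ * ∑ i ∈ Finset.range n, D s t (X (i + 1) ω) := fun s t ω =>
    truncatedSum_sub hX_ident ε n ω s t
  have hmom := integral_abs_sum_rpow_mul_abs_sum_rpow_le (W := fun i => X (i + 1)) hp hp2
    (fun i => hX_meas (i + 1)) (hX_indep.precomp (add_left_injective 1))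
    (fun i => hX_ident (i + 1)) (hDb s t) (hDb t u) (hD0 s t) (hD0 t u) n
  have e1 := h_single s t hst
  have e2 := h_single t u htu
  have e3 := h_product s t u hst htu
  simp only [centeredIncrement_eq (hX_meas 0)] at e1 e2 e3
  have hap : (a n) ^ (-2 * p) = (a n) ^ (-p) * (a n) ^ (-p) := by
    rw [← Real.rpow_add han]; congr 1; ring
  have hainv : ∀ y : ℝ, |(a n)⁻¹ * y| ^ p = (a n) ^ (-p) * |y| ^ p := fun y => by
    rw [abs_mul, Real.mul_rpow (abs_nonneg _) (abs_nonneg _), abs_of_pos (inv_pos.2 han),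
      Real.inv_rpow han.le, Real.rpow_neg han.le]
  have hxp : x ^ (-(2 * p)) = (x ^ p * x ^ p)⁻¹ := by
    rw [Real.rpow_neg hx.le, two_mul, Real.rpow_add hx]
  have hGst : 0 ≤ G t - G s := sub_nonneg.2 (hG hst.le)
  have hGtu : 0 ≤ G u - G t := sub_nonneg.2 (hG htu.le)
  have hGsu : 0 ≤ G u - G s := by linarith
  have hGG : (G t - G s) ^ γ * (G u - G t) ^ γ ≤ (G u - G s) ^ (2 * γ) := by
    rw [two_mul, Real.rpow_add_of_nonneg hGsu hγ hγ]
    exact mul_le_mul (Real.rpow_le_rpow hGst (by linarith) hγ)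
      (Real.rpow_le_rpow hGtu (by linarith) hγ) (Real.rpow_nonneg hGtu _) (Real.rpow_nonneg hGsu _)
  have hmarkov := mul_meas_ge_le_integral_of_nonneg (μ := μ)
    (f := fun ω => (a n) ^ (-2 * p) * (|∑ i ∈ Finset.range n, D s t (X (i + 1) ω)| ^ p *
      |∑ i ∈ Finset.range n, D t u (X (i + 1) ω)| ^ p))
    (Eventually.of_forall fun ω => by simp only [Pi.zero_apply]; positivity)
    (((BddMeasurable.const _).mul (((hDsum s t).abs_rpow hp0).mul
      ((hDsum t u).abs_rpow hp0))).integrable μ) (x ^ p * x ^ p)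
  rw [integral_const_mul] at hmarkov
  have hxpos : 0 < x ^ p * x ^ p := by positivity
  calc _ ≤ μ.real {ω | x ^ p * x ^ p ≤ (a n) ^ (-2 * p) *
          (|∑ i ∈ Finset.range n, D s t (X (i + 1) ω)| ^ p *
            |∑ i ∈ Finset.range n, D t u (X (i + 1) ω)| ^ p)} := measureReal_mono ?_
    _ ≤ (x ^ p * x ^ p)⁻¹ * (297 * (G u - G s) ^ (2 * γ)) := by
        rw [le_inv_mul_iff₀ hxpos]
        refine hmarkov.trans ?_
        have ha0 : 0 ≤ (a n) ^ (-2 * p) := by positivity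
        refine (mul_le_mul_of_nonneg_left hmom ha0).trans ?_
        have e4 := mul_le_mul e1 e2 (mul_nonneg (by positivity)
          (integral_nonneg fun ω => by positivity)) (Real.rpow_nonneg hGst γ)
        have e5 := e4.trans hGG
        rw [hap] at e3 ⊢
        simp only [hD]
        linarith
    _ = _ := by rw [hxp]; ring
  rintro ω ⟨h1, h2⟩
  rw [hU] at h1 h2
  simp only [mem_ofPred_eq]
  rw [hap, mul_mul_mul_comm, ← hainv, ← hainv]
  exact mul_le_mul (Real.rpow_le_rpow hx.le h1 hp0) (Real.rpow_le_rpow hx.le h2 hp0)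
    (by positivity) (by positivity)

end TruncatedSum

end

/-! ### Assembly of the grid-point and cell estimates. -/

/-- `X 0` plays the role of the generic element `X`, and `X 1, X 2, …` are the summands. -/
theorem mainTheorem11 {Ω : Type*} [MeasurableSpace Ω] (μ : Measure Ω) [IsProbabilityMeasure μ]
    {l r : ℝ} (hlr : l ≤ r)
    (X : ℕ → Ω → CadlagSpace l r)
    (hX_meas : ∀ i, Measurable (X i))
    (hX_indep : iIndepFun X μ)
    (hX_ident : ∀ i, IdentDistrib (X i) (X 0) μ μ)
    (α : ℝ) (hα : 1 < α ∧ α < 2)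
    (hX_reg : HasRegularlyVaryingTail μ (fun ω => supNorm (X 0 ω)) α)
    (a : ℕ → ℝ) (ha_mono : Monotone a)
    (ha : Tendsto (fun n : ℕ => (n : ℝ) * μ.real {ω | a n < supNorm (X 0 ω)}) atTop (𝓝 1))
    (p : ℝ) (hp : α < p ∧ p ≤ 2) (γ : ℝ) (hγ : 1 / 2 < γ)
    (F : Icc l r → ℝ) (hF_cont : Continuous F) (hF_mono : Monotone F)
    (Fn : ℕ → Icc l r → ℝ) (hFn_mono : ∀ n, 1 ≤ n → Monotone (Fn n))
    (hFn : ∀ t, Tendsto (fun n => Fn n t) atTop (𝓝 (F t)))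
    (h_single : ∀ n : ℕ, 1 ≤ n → ∀ ε : ℝ, 0 < ε → ε ≤ 1 → ∀ s t : Icc l r, s < t →
      (n : ℝ) * (a n) ^ (-p) * ∫ ω, |centeredIncrement μ (X 0) (a n * ε) s t ω| ^ p ∂μ
        ≤ (Fn n t - Fn n s) ^ γ)
    (h_product : ∀ n : ℕ, 1 ≤ n → ∀ ε : ℝ, 0 < ε → ε ≤ 1 → ∀ s t u : Icc l r, s < t → t < u →
      (n : ℝ) ^ 2 * (a n) ^ (-2 * p) *
          ∫ ω, |centeredIncrement μ (X 0) (a n * ε) s t ω| ^ p *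
            |centeredIncrement μ (X 0) (a n * ε) t u ω| ^ p ∂μ
        ≤ (Fn n u - Fn n s) ^ (2 * γ)) :
    ∀ η : ℝ, 0 < η →
      Tendsto
        (fun ε : ℝ => limsup (fun n : ℕ => μ {ω | η < supNorm (truncatedSum μ X a ε n ω)}) atTop)
        (𝓝[>] 0) (𝓝 0) := by
  intro η hη
  have hp1 : 1 < p := hα.1.trans hp.1
  have hη2 : 0 < η / 2 := half_pos hη
  obtain ⟨θ, K, hθ, hθ1, hK0, hK⟩ :=
    exists_chaining_constants (q := 2 * p) (β := 2 * γ) (by linarith) (by linarith)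
  obtain ⟨C, x₀, hC0, hC⟩ := hX_reg.exists_truncated_second_moment_le hα.2
    (CadlagSpace.measurable_supNorm.comp (hX_meas 0)) (fun ω => CadlagSpace.supNorm_nonneg _)
  rw [ENNReal.tendsto_nhds_zero]
  intro δ' hδ'
  obtain ⟨δ, hδ, hδδ'⟩ : ∃ δ : ℝ, 0 < δ ∧ ENNReal.ofReal δ ≤ δ' := by
    obtain ⟨δ, hδ1, hδ2⟩ := ENNReal.lt_iff_exists_real_btwn.1 hδ'
    exact ⟨δ, ENNReal.ofReal_pos.1 hδ2.1, hδ2.2.le⟩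
  set L := K * (297 * (η / 2) ^ (-(2 * p))) with hL
  have hL0 : 0 ≤ L := by positivity
  -- The grid depends on `δ` and `η` but not on `ε`. Dividing by `L + 1` avoids dividing by a
  -- possibly zero `L`.
  obtain ⟨N, τ, hτm, hτ, hFτ⟩ := exists_grid hlr hF_cont hF_mono (β := 2 * γ) (by linarith)
    (δ := δ / 2 / (L + 1)) (by positivity)
  have hFτ' : L * ∑ i ∈ Finset.range N, (F (τ (i + 1)) - F (τ i)) ^ (2 * γ) < δ / 2 := by
    rw [lt_div_iff₀ (by positivity)] at hFτ
    have : 0 ≤ ∑ i ∈ Finset.range N, (F (τ (i + 1)) - F (τ i)) ^ (2 * γ) :=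
      Finset.sum_nonneg fun i _ => Real.rpow_nonneg (sub_nonneg.2 (hF_mono (hτm i.le_succ))) _
    linarith
  -- One Chebyshev-Karamata bound for each of the `N + 1` grid points.
  set H := ((N + 1 : ℕ) : ℝ) * (4 * ((η / 2) ^ 2)⁻¹ * C) with hH
  have hεlim : Tendsto (fun ε : ℝ => H * (ε ^ 2 * ε ^ (-α))) (𝓝[>] 0) (𝓝 0) := by
    have h1 : Tendsto (fun ε : ℝ => H * ε ^ (2 - α)) (𝓝[>] 0) (𝓝 (H * 0)) := by
      have := (Real.continuousAt_rpow_const 0 (2 - α) (Or.inr (by linarith))).tendsto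
      rw [Real.zero_rpow (by linarith)] at this
      exact (this.mono_left nhdsWithin_le_nhds).const_mul H
    rw [mul_zero] at h1
    refine h1.congr' ?_
    filter_upwards [self_mem_nhdsWithin] with ε (hε : 0 < ε)
    rw [sub_eq_add_neg, Real.rpow_add hε, Real.rpow_two]
  have hε1 : ∀ᶠ ε : ℝ in 𝓝[>] 0, ε ≤ 1 :=
    (eventually_le_nhds zero_lt_one).filter_mono nhdsWithin_le_nhds
  filter_upwards [hεlim.eventually_lt_const (half_pos hδ), hε1, self_mem_nhdsWithin]
    with ε hεH hε1 (hε : 0 < ε)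
  refine le_trans ?_ hδδ'
  refine limsup_le_of_le (by isBoundedDefault) ?_
  have hlim1 := (hX_reg.tendsto_mul_measureReal ha hε).const_mul (H * ε ^ 2)
  have hlim2 : Tendsto (fun n => L * ∑ i ∈ Finset.range N, (Fn n (τ (i + 1)) - Fn n (τ i)) ^ (2 * γ))
      atTop (𝓝 (L * ∑ i ∈ Finset.range N, (F (τ (i + 1)) - F (τ i)) ^ (2 * γ))) :=
    (tendsto_finsetSum _ fun i _ =>
      ((hFn _).sub (hFn _)).rpow_const (Or.inr (by linarith))).const_mul L
  have ha_top := hX_reg.tendsto_scale_atTop ha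
  -- The limits in `n` of the grid-point and cell bounds are each below `δ / 2`. Pointwise
  -- convergence of `Fn` suffices, as only the finitely many grid points enter.
  filter_upwards [(hlim1.add hlim2).eventually_lt_const (show _ < δ by linarith),
    ha_top.eventually_gt_atTop 0, (ha_top.atTop_mul_const hε).eventually_ge_atTop x₀,
    eventually_ge_atTop 1] with n hn han hanx hn1
  have hpt : ∀ i, μ {ω | η / 2 ≤ |truncatedSum μ X a ε n ω (τ i)|} ≤
      ENNReal.ofReal (4 * ((η / 2) ^ 2)⁻¹ * C *
        (ε ^ 2 * (n * μ.real {ω | a n * ε < supNorm (X 0 ω)}))) := fun i => by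
    have h1 := measureReal_le_abs_truncatedSum_le hX_meas hX_indep hX_ident (a := a) ε n (τ i) hη2
    have h2 := hC _ hanx
    rw [← ofReal_measureReal]
    refine ENNReal.ofReal_le_ofReal (h1.trans ?_)
    calc _ ≤ 4 * ((η / 2) ^ 2)⁻¹ * (n * ((a n)⁻¹ ^ 2 * (C * ((a n * ε) ^ 2 *
          μ.real {ω | a n * ε < supNorm (X 0 ω)})))) := by gcongr
      _ = _ := by field_simp
  have hseg : ∀ i, μ {ω | ∃ t, τ i ≤ t ∧ t ≤ τ (i + 1) ∧
      η / 2 < |truncatedSum μ X a ε n ω t - truncatedSum μ X a ε n ω (τ i)| ∧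
      η / 2 < |truncatedSum μ X a ε n ω (τ (i + 1)) - truncatedSum μ X a ε n ω t|} ≤
      ENNReal.ofReal (L * (Fn n (τ (i + 1)) - Fn n (τ i)) ^ (2 * γ)) := fun i => by
    refine measure_exists_lt_le_of_finset
      (continuousWithinAt_truncatedSum hX_meas hX_ident ε n) hη2 fun A hA => ?_
    have h1 := measureReal_exists_le_of_product_bound (hFn_mono n hn1) (by norm_num : (0 : ℝ) ≤ 297)
      (by linarith) hθ hθ1 hK0 hK
      (measureReal_truncatedSum_product_le hp1 hp.2 (by linarith) hX_meas hX_indep hX_ident han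
        (hFn_mono n hn1) (h_single n hn1 ε hε hε1) (h_product n hn1 ε hε hε1))
      A (τ i) (τ (i + 1)) (hτm i.le_succ) hA (η / 2) hη2
    rwa [← mul_assoc] at h1
  have hnn1 : 0 ≤ 4 * ((η / 2) ^ 2)⁻¹ * C *
      (ε ^ 2 * (n * μ.real {ω | a n * ε < supNorm (X 0 ω)})) := by positivity
  have hnn2 : ∀ i, 0 ≤ L * (Fn n (τ (i + 1)) - Fn n (τ i)) ^ (2 * γ) := fun i =>
    mul_nonneg hL0 (Real.rpow_nonneg (sub_nonneg.2 (hFn_mono n hn1 (hτm i.le_succ))) _)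
  calc μ {ω | η < supNorm (truncatedSum μ X a ε n ω)}
      ≤ _ := measure_mono (lt_supNorm_subset hη hτ)
    _ ≤ _ := measure_union_le _ _
    _ ≤ _ := add_le_add (measure_biUnion_finset_le _ _) (measure_biUnion_finset_le _ _)
    _ ≤ _ := add_le_add (Finset.sum_le_sum fun i _ => hpt i) (Finset.sum_le_sum fun i _ => hseg i)
    _ = ENNReal.ofReal (H * ε ^ 2 * (n * μ.real {ω | a n * ε < supNorm (X 0 ω)}) +
          L * ∑ i ∈ Finset.range N, (Fn n (τ (i + 1)) - Fn n (τ i)) ^ (2 * γ)) := by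
        rw [← ENNReal.ofReal_sum_of_nonneg fun i _ => hnn1,
          ← ENNReal.ofReal_sum_of_nonneg fun i _ => hnn2 i,
          ← ENNReal.ofReal_add (Finset.sum_nonneg fun i _ => hnn1)
            (Finset.sum_nonneg fun i _ => hnn2 i),
          Finset.sum_const, Finset.card_range, nsmul_eq_mul, Finset.mul_sum]
        congr 2
        rw [hH]
        ring
    _ ≤ _ := ENNReal.ofReal_le_ofReal hn.le
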